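/- Let $f:\mathbb{R}^d\to\mathbb{R}$ be of class $C^2$, let $x_*$ be a local minimizer of $f$ such that $f$ is not constant in any neighborhood of $x_*$, and assume the local Polyak–Łojasiewicz condition at $x_*$: there are an open neighborhood $V$ of $x_*$ and $\nu>0$ with $\|\nabla f(x)\|^2\ge 2\nu\,(f(x)-f(x_*))$ for all $x\in V$. Let $\mathcal S$ be the set of local minimizers $x$ of $f$ with $f(x)=f(x_*)$, let $T$ be the tangent space of $\mathcal S$ at $x_*$ (spanned by the velocities $\gamma'(0)$ of $C^1$ curves $\gamma:(-\delta,\delta)\to\mathcal S$ with $\gamma(0)=x_*$), let $N=T^\perp$, and let $\mu$ and $L$ be the smallest and the largest eigenvalue of $\nabla^2 f(x_*)$ restricted to $N$. For real $\alpha,\beta$ put $\mathcal G_\alpha=(I-\alpha\nabla^2 f(x_*))|_N$ and let $\rho_{\alpha,\beta}$ be the spectral radius (the largest modulus of a complex eigenvalue) of the operator $$\begin{pmatrix}(1+\beta)\mathcal G_\alpha&-\beta\mathcal G_\alpha&0\\ I&0&0\\ 0&0&\beta I\end{pmatrix}\quad\text{on } N\times N\times T.$$ For starting points $x^0,x^1\in\mathbb{R}^d$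 let $(x^n)$ be the NAG sequence $y^n=x^n+\beta(x^n-x^{n-1})$, $x^{n+1}=y^n-\alpha\nabla f(y^n)$, $n\ge1$. (1) Let $\varepsilon>0$, $\beta\in[0,1)$ and $0<\alpha<\frac{2(\beta+1)}{(L+\varepsilon)(2\beta+1)}$. Then $\rho_{\alpha,\beta}\in[0,1)$, and there are an open neighborhood $U$ of $x_*$ and a constant $C>0$ (depending on $f,x_*,\varepsilon,\alpha,\beta$ only) such that for all $x^0,x^1\in U$ the NAG sequence converges to some $x_*'\in\mathcal S$ with $\|x_*'-x_*\|<\varepsilon$, and $$\|x^n-x_*'\|\le C\big(\|x^1-x_*'\|+\|x^0-x_*'\|\big)(\rho_{\alpha,\beta}+\varepsilon)^n\qquad\text{for all } n\ge1.$$ (2) Let $\alpha_{\rm opt}=\frac{4}{3L+\mu}$, $\beta_{\rm opt}=\frac{\sqrt{3L+\mu}-2\sqrt\mu}{\sqrt{3L+\mu}+2\sqrt\mu}$ and $\rho_{\rm opt}=\frac{\sqrt{3L+\mu}-2\sqrt\mu}{\sqrt{3L+\mu}}$. Then $\beta_{\rm opt}\in[0,1)$, $0<\alpha_{\rm opt}<\frac{2(\beta_{\rm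 opt}+1)}{L(2\beta_{\rm opt}+1)}$, $\rho_{\alpha_{\rm opt},\beta_{\rm opt}}=\rho_{\rm opt}$, and $\rho_{\rm opt}\le\rho_{\alpha,\beta}$ for all $\beta\in[0,1)$ and $0<\alpha<\frac{2(\beta+1)}{L(2\beta+1)}$. Moreover, for every $\varepsilon>0$ there are an open neighborhood $U$ of $x_*$ and a constant $C>0$ such that for all $x^0,x^1\in U$ the NAG sequence with $\alpha=\alpha_{\rm opt}$, $\beta=\beta_{\rm opt}$ converges to some $x_*'\in\mathcal S$ with $\|x_*'-x_*\|<\varepsilon$, and $$\|x^n-x_*'\|\le C\big(\|x^1-x_*'\|+\|x^0-x_*'\|\big)(\rho_{\rm opt}+\varepsilon)^n\qquad\text{for all } n\ge1.$$ -/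

import Mathlib

open Set Filter Topology

noncomputable section

namespace NAG

/-- Euclidean space `ℝ^d`. -/
abbrev Vec (d : ℕ) : Type := EuclideanSpace ℝ (Fin d)

/-- The sequence `x^0, x^1, x^2, …` of Nesterov's accelerated gradient method:
`y^n = x^n + β (x^n - x^{n-1})`, `x^{n+1} = y^n - α ∇f(y^n)` for `n ≥ 1`. -/
def iter {d : ℕ} (f : Vec d → ℝ) (α β : ℝ) (x₀ x₁ : Vec d) : ℕ → Vec d
  | 0 => x₀
  | 1 => x₁
  | n + 2 =>
    let y := iter f α β x₀ x₁ (n + 1) +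
      β • (iter f α β x₀ x₁ (n + 1) - iter f α β x₀ x₁ n)
    y - α • gradient f y

/-- The local Polyak–Łojasiewicz condition of `f` at `xs`. -/
def LocalPL {d : ℕ} (f : Vec d → ℝ) (xs : Vec d) : Prop :=
  ∃ U : Set (Vec d), IsOpen U ∧ xs ∈ U ∧
    ∃ ν : ℝ, 0 < ν ∧ ∀ x ∈ U, 2 * ν * (f x - f xs) ≤ ‖gradient f x‖ ^ 2

/-- The set `S` of local minimizers of `f` at the level `f xs`. -/
def minSet {d : ℕ} (f : Vec d → ℝ) (xs : Vec d) : Set (Vec d) :=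
  {x | IsLocalMin f x ∧ f x = f xs}

/-- Velocities `γ'(0)` of the `C^1` curves `γ : (-δ, δ) → S` with `γ(0) = x`. Since `δ` may be
decreased, replacing `S` by `S ∩ U` for an open neighbourhood `U` of `x` changes nothing. -/
def velocities {d : ℕ} (S : Set (Vec d)) (x : Vec d) : Set (Vec d) :=
  {w | ∃ (δ : ℝ) (γ : ℝ → Vec d), 0 < δ ∧ ContDiffOn ℝ 1 γ (Ioo (-δ) δ) ∧
    (∀ t ∈ Ioo (-δ) δ, γ t ∈ S) ∧ γ 0 = x ∧ deriv γ 0 = w}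

/-- The tangent space `T` of `S` at `xs`. The span only serves to make it a subspace by
construction: where `S` is a `C^1` submanifold, the velocities already form a subspace. -/
def tangentSpace {d : ℕ} (f : Vec d → ℝ) (xs : Vec d) : Submodule ℝ (Vec d) :=
  Submodule.span ℝ (velocities (minSet f xs) xs)

/-- The normal space `N` of `S` at `xs`. -/
def normalSpace {d : ℕ} (f : Vec d → ℝ) (xs : Vec d) : Submodule ℝ (Vec d) :=
  (tangentSpace f xs)ᗮ

/-- The Hessian of `f` at `x`, as a linear operator on `ℝ^d`. -/
def hessian {d : ℕ} (f : Vec d → ℝ) (x : Vec d) : Vec d →ₗ[ℝ] Vec d :=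
  (fderiv ℝ (gradient f) x : Vec d →ₗ[ℝ] Vec d)

/-- The Hessian at `xs` restricted to the normal space, as an operator `N → N` (the projection
on the left only provides the codomain). -/
def normalHessian {d : ℕ} (f : Vec d → ℝ) (xs : Vec d) :
    normalSpace f xs →ₗ[ℝ] normalSpace f xs :=
  ((normalSpace f xs).orthogonalProjectionOnto : Vec d →ₗ[ℝ] normalSpace f xs) ∘ₗ
    hessian f xs ∘ₗ (normalSpace f xs).subtype

/-- The smallest eigenvalue of the Hessian on the normal space. -/
def muConst {d : ℕ} (f : Vec d → ℝ) (xs : Vec d) : ℝ :=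
  sInf {t : ℝ | Module.End.HasEigenvalue (normalHessian f xs) t}

/-- The largest eigenvalue of the Hessian on the normal space. -/
def lipConst {d : ℕ} (f : Vec d → ℝ) (xs : Vec d) : ℝ :=
  sSup {t : ℝ | Module.End.HasEigenvalue (normalHessian f xs) t}

/-- The operator `I - α ∇²f(xs)` on the normal space. -/
def normalStep {d : ℕ} (f : Vec d → ℝ) (xs : Vec d) (α : ℝ) :
    normalSpace f xs →ₗ[ℝ] normalSpace f xs :=
  LinearMap.id - α • normalHessian f xs

/-- The linearization on `N × N × T`:
`(a, b, t) ↦ ((1 + β) 𝒢 a - β 𝒢 b, a, β t)` with `𝒢 = I - α ∇²f(xs)`. -/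
def blockOp {d : ℕ} (f : Vec d → ℝ) (xs : Vec d) (α β : ℝ) :
    (normalSpace f xs × normalSpace f xs × tangentSpace f xs) →ₗ[ℝ]
      (normalSpace f xs × normalSpace f xs × tangentSpace f xs) where
  toFun p := ((1 + β) • normalStep f xs α p.1 - β • normalStep f xs α p.2.1, p.1, β • p.2.2)
  map_add' p q := by
    ext1
    · simp only [Prod.fst_add, Prod.snd_add, map_add, smul_add]
      abel
    · simp [smul_add]
  map_smul' c p := by
    ext1
    · simp only [Prod.smul_fst, Prod.smul_snd, map_smul, RingHom.id_apply, smul_sub,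
        smul_comm c]
    · simp [smul_comm c]

/-- The spectral radius (largest modulus of a complex eigenvalue) of an endomorphism of a
finite-dimensional real space, i.e. that of its complexification. -/
def realSpectralRadius {V : Type*} [AddCommGroup V] [Module ℝ V] (A : V →ₗ[ℝ] V) : ℝ :=
  (spectralRadius ℂ (A.baseChange ℂ : Module.End ℂ (TensorProduct ℝ ℂ V))).toReal

/-- The factor `ρ_{α,β}`: spectral radius of the linearized block operator. -/
def rho {d : ℕ} (f : Vec d → ℝ) (xs : Vec d) (α β : ℝ) : ℝ :=
  realSpectralRadius (blockOp f xs α β)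

/-- Local linear convergence of the method at `xs` with factor `q`, the limit being a minimizer
within distance `ε` of `xs`. The constant `C` does not depend on the starting points. -/
def ConvergesLinearly {d : ℕ} (f : Vec d → ℝ) (xs : Vec d) (α β ε q : ℝ) : Prop :=
  ∃ U : Set (Vec d), IsOpen U ∧ xs ∈ U ∧ ∃ C : ℝ, 0 < C ∧
    ∀ x₀ ∈ U, ∀ x₁ ∈ U, ∃ x' ∈ minSet f xs, ‖x' - xs‖ < ε ∧
      Tendsto (iter f α β x₀ x₁) atTop (𝓝 x') ∧
      ∀ n : ℕ, 1 ≤ n →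
        ‖iter f α β x₀ x₁ n - x'‖ ≤ C * (‖x₁ - x'‖ + ‖x₀ - x'‖) * q ^ n

/-- The step size `4 / (3L + μ)`. -/
def alphaOpt (L μ : ℝ) : ℝ := 4 / (3 * L + μ)

/-- The momentum parameter `(√(3L+μ) - 2√μ) / (√(3L+μ) + 2√μ)`. -/
def betaOpt (L μ : ℝ) : ℝ :=
  (√(3 * L + μ) - 2 * √μ) / (√(3 * L + μ) + 2 * √μ)

/-- The rate `(√(3L+μ) - 2√μ) / √(3L+μ)`. -/
def rhoOpt (L μ : ℝ) : ℝ := (√(3 * L + μ) - 2 * √μ) / √(3 * L + μ)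

end NAG

end

/-! Geometry. Where the component of the gradient normal to ker ∇²f(xs) vanishes, the points near
`xs` form a graph `Ψ` over that kernel. Restricted to the graph, f has a gradient with arbitrarily
small Lipschitz constant near `xs`, so a descent step bounds ‖∇f‖² by a small multiple of f - f(xs).
This contradicts the Polyak–Łojasiewicz inequality unless f is constant on the graph. Hence the
graph consists of minimizers (`exists_minSet_parametrization`), T is the kernel
(`tangentSpace_eq_ker`), and the Hessian is positive definite on N.

Convergence. On pairs (x^n, x^{n-1}) the linearized method acts on T × T with eigenvalues 1 and β.
The eigenvalue 1 is motion along the minimizers, and it is read off from the tangential part of (x^n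
- βx^{n-1})/(1-β), which the linearized step preserves. Sending a pair to the minimizer over this
value is a retraction σ. The deviation z - σ z is driven by `blockOp` up to a small error, so it
contracts at any factor above its spectral radius in the norm of `exists_adapted_norm`, while the
base point drifts by a summable amount (`exists_limit_of_contracts_to_retract`,
`convergesLinearly_of_rho_lt`).

Rate. Every eigenvalue of `blockOp` is β or a root of z² - (1+β)(1-αh)z + β(1-αh) with h an
eigenvalue on N (`eq_or_root_of_mem_spectrum_blockOp`). Root location is decided by the signs of the
quadratic at ±R and by the size of its constant term. For h = μ and h = L these conditions already
force the optimal bound (`rate_inequality`), and at the optimal parameters they hold for all h in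
[μ, L] (`norm_root_le_rhoOpt`). -/

namespace NAG

/-! ### Complexification, spectral radius and adapted norms -/

open TensorProduct in
theorem exists_eq_one_tmul_add_I_tmul {V : Type*} [AddCommGroup V] [Module ℝ V]
    (w : ℂ ⊗[ℝ] V) : ∃ p q : V, w = (1 : ℂ) ⊗ₜ[ℝ] p + Complex.I ⊗ₜ[ℝ] q := by
  induction w using TensorProduct.induction_on with
  | zero => exact ⟨0, 0, by simp⟩
  | tmul z v =>
    refine ⟨z.re • v, z.im • v, ?_⟩
    rw [tmul_smul, tmul_smul, smul_tmul', smul_tmul', ← add_tmul]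
    congr 1
    apply Complex.ext <;> simp
  | add x y hx hy =>
    obtain ⟨p, q, rfl⟩ := hx
    obtain ⟨p', q', rfl⟩ := hy
    refine ⟨p + p', q + q', ?_⟩
    rw [tmul_add, tmul_add]
    abel

open TensorProduct in
theorem one_tmul_add_I_tmul_inj {V : Type*} [AddCommGroup V] [Module ℝ V] {p q p' q' : V} :
    (1 : ℂ) ⊗ₜ[ℝ] p + Complex.I ⊗ₜ[ℝ] q = (1 : ℂ) ⊗ₜ[ℝ] p' + Complex.I ⊗ₜ[ℝ] q' ↔
      p = p' ∧ q = q' := by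
  refine ⟨fun h => ⟨?_, ?_⟩, fun h => by rw [h.1, h.2]⟩
  · have := congrArg (fun w => TensorProduct.lid ℝ V (Complex.reLm.rTensor V w)) h
    simpa using this
  · have := congrArg (fun w => TensorProduct.lid ℝ V (Complex.imLm.rTensor V w)) h
    simpa using this

open TensorProduct in
/-- Complex eigenvalues of a real operator in terms of the real and imaginary parts of an
eigenvector. -/
theorem mem_spectrum_baseChange_iff {V : Type*} [AddCommGroup V] [Module ℝ V]
    [FiniteDimensional ℝ V] (B : V →ₗ[ℝ] V) (z : ℂ) :
    z ∈ spectrum ℂ (B.baseChange ℂ : Module.End ℂ (ℂ ⊗[ℝ] V)) ↔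
      ∃ p q : V, (p ≠ 0 ∨ q ≠ 0) ∧ B p = z.re • p - z.im • q ∧
        B q = z.im • p + z.re • q := by
  have key : ∀ p q : V, B.baseChange ℂ ((1 : ℂ) ⊗ₜ[ℝ] p + Complex.I ⊗ₜ[ℝ] q) =
      z • ((1 : ℂ) ⊗ₜ[ℝ] p + Complex.I ⊗ₜ[ℝ] q) ↔
      B p = z.re • p - z.im • q ∧ B q = z.im • p + z.re • q := by
    intro p q
    have h1 : z • ((1 : ℂ) ⊗ₜ[ℝ] p + Complex.I ⊗ₜ[ℝ] q) =
        (1 : ℂ) ⊗ₜ[ℝ] (z.re • p - z.im • q) + Complex.I ⊗ₜ[ℝ] (z.im • p + z.re • q) := by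
      have e1 : z = z.re • (1 : ℂ) + z.im • Complex.I := by apply Complex.ext <;> simp
      have e2 : z * Complex.I = z.re • Complex.I - z.im • (1 : ℂ) := by
        apply Complex.ext <;> simp
      rw [smul_add, smul_tmul', smul_tmul', smul_eq_mul, smul_eq_mul, mul_one, e2,
        tmul_sub, tmul_add, tmul_smul, tmul_smul, tmul_smul, tmul_smul, sub_tmul,
        ← smul_tmul', ← smul_tmul']
      have e3 : z ⊗ₜ[ℝ] p = z.re • ((1 : ℂ) ⊗ₜ[ℝ] p) + z.im • (Complex.I ⊗ₜ[ℝ] p) := by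
        rw [smul_tmul', smul_tmul', ← add_tmul, ← e1]
      rw [e3]
      abel
    rw [h1, map_add, LinearMap.baseChange_tmul, LinearMap.baseChange_tmul,
      one_tmul_add_I_tmul_inj]
  rw [← Module.End.hasEigenvalue_iff_mem_spectrum]
  constructor
  · intro h
    obtain ⟨w, hw⟩ := h.exists_hasEigenvector
    obtain ⟨p, q, rfl⟩ := exists_eq_one_tmul_add_I_tmul w
    refine ⟨p, q, ?_, (key p q).1 hw.apply_eq_smul⟩
    by_contra hc
    push Not at hc
    exact hw.2 (by rw [hc.1, hc.2]; simp)
  · rintro ⟨p, q, hpq, h⟩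
    refine Module.End.hasEigenvalue_of_hasEigenvector
      (x := (1 : ℂ) ⊗ₜ[ℝ] p + Complex.I ⊗ₜ[ℝ] q) ⟨?_, ?_⟩
    · rw [Module.End.mem_eigenspace_iff]
      exact (key p q).2 h
    · intro h0
      have h1 : (1 : ℂ) ⊗ₜ[ℝ] p + Complex.I ⊗ₜ[ℝ] q =
          (1 : ℂ) ⊗ₜ[ℝ] (0 : V) + Complex.I ⊗ₜ[ℝ] (0 : V) := by rw [h0]; simp
      have h2 := one_tmul_add_I_tmul_inj.1 h1
      rcases hpq with hp | hq
      · exact hp h2.1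
      · exact hq h2.2

attribute [local instance] Matrix.linftyOpNormedRing Matrix.linftyOpNormedAlgebra

/-- The complex matrix of a real operator in a basis. -/
noncomputable def complexMatrix {V : Type*} [AddCommGroup V] [Module ℝ V] {n : ℕ}
    (b : Module.Basis (Fin n) ℝ V) (B : V →ₗ[ℝ] V) : Matrix (Fin n) (Fin n) ℂ :=
  (LinearMap.toMatrix b b B).map (algebraMap ℝ ℂ)

-- Passing to matrices gives a complete normed algebra, in which compactness of the spectrum and
-- Gelfand's formula are available.
open TensorProduct in
theorem spectrum_complexMatrix {V : Type*} [AddCommGroup V] [Module ℝ V] {n : ℕ}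
    (b : Module.Basis (Fin n) ℝ V) (B : V →ₗ[ℝ] V) :
    spectrum ℂ (complexMatrix b B) =
      spectrum ℂ (B.baseChange ℂ : Module.End ℂ (ℂ ⊗[ℝ] V)) := by
  have h := AlgEquiv.spectrum_eq (R := ℂ) (LinearMap.toMatrixAlgEquiv (Algebra.TensorProduct.basis ℂ b))
    (B.baseChange ℂ : Module.End ℂ (ℂ ⊗[ℝ] V))
  rw [← h, complexMatrix, ← LinearMap.toMatrix_baseChange]
  rfl

open TensorProduct in
theorem spectralRadius_complexMatrix {V : Type*} [AddCommGroup V] [Module ℝ V] {n : ℕ}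
    (b : Module.Basis (Fin n) ℝ V) (B : V →ₗ[ℝ] V) :
    spectralRadius ℂ (complexMatrix b B) =
      spectralRadius ℂ (B.baseChange ℂ : Module.End ℂ (ℂ ⊗[ℝ] V)) := by
  simp only [spectralRadius, spectrum_complexMatrix]

open TensorProduct in
theorem spectralRadius_baseChange_ne_top {V : Type*} [AddCommGroup V] [Module ℝ V]
    [FiniteDimensional ℝ V] (B : V →ₗ[ℝ] V) :
    spectralRadius ℂ (B.baseChange ℂ : Module.End ℂ (ℂ ⊗[ℝ] V)) ≠ ⊤ := by
  rw [← spectralRadius_complexMatrix (Module.finBasis ℝ V) B]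
  rcases (spectrum ℂ (complexMatrix (Module.finBasis ℝ V) B)).eq_empty_or_nonempty with he | hne
  · simp [spectralRadius, he]
  · obtain ⟨z, -, hz⟩ := spectrum.exists_nnnorm_eq_spectralRadius_of_nonempty hne
    rw [← hz]
    exact ENNReal.coe_ne_top

open TensorProduct in
theorem norm_le_realSpectralRadius {V : Type*} [AddCommGroup V] [Module ℝ V]
    [FiniteDimensional ℝ V] (B : V →ₗ[ℝ] V) {z : ℂ}
    (hz : z ∈ spectrum ℂ (B.baseChange ℂ : Module.End ℂ (ℂ ⊗[ℝ] V))) :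
    ‖z‖ ≤ realSpectralRadius B := by
  have h : (‖z‖₊ : ENNReal) ≤
      spectralRadius ℂ (B.baseChange ℂ : Module.End ℂ (ℂ ⊗[ℝ] V)) :=
    le_iSup₂ (f := fun (k : ℂ) (_ : k ∈ spectrum ℂ (B.baseChange ℂ :
      Module.End ℂ (ℂ ⊗[ℝ] V))) => (‖k‖₊ : ENNReal)) z hz
  have := ENNReal.toReal_mono (spectralRadius_baseChange_ne_top B) h
  simpa [realSpectralRadius] using this

open TensorProduct in
theorem realSpectralRadius_le {V : Type*} [AddCommGroup V] [Module ℝ V]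
    (B : V →ₗ[ℝ] V) {R : ℝ} (hR : 0 ≤ R)
    (h : ∀ z ∈ spectrum ℂ (B.baseChange ℂ : Module.End ℂ (ℂ ⊗[ℝ] V)), ‖z‖ ≤ R) :
    realSpectralRadius B ≤ R := by
  refine ENNReal.toReal_le_of_le_ofReal hR ?_
  refine iSup₂_le fun z hz => ?_
  rw [← enorm_eq_nnnorm, ← ofReal_norm]
  exact ENNReal.ofReal_le_ofReal (h z hz)

-- The strict bound survives the supremum because the spectrum is compact and the supremum is
-- attained. An empty spectrum gives radius 0, which is why `R` must be positive.
open TensorProduct in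
theorem realSpectralRadius_lt {V : Type*} [AddCommGroup V] [Module ℝ V]
    [FiniteDimensional ℝ V] (B : V →ₗ[ℝ] V) {R : ℝ} (hR : 0 < R)
    (h : ∀ z ∈ spectrum ℂ (B.baseChange ℂ : Module.End ℂ (ℂ ⊗[ℝ] V)), ‖z‖ < R) :
    realSpectralRadius B < R := by
  rcases (spectrum ℂ (B.baseChange ℂ : Module.End ℂ (ℂ ⊗[ℝ] V))).eq_empty_or_nonempty with
    he | hne
  · refine (realSpectralRadius_le B le_rfl fun z hz => ?_).trans_lt hR
    rw [he] at hz
    exact hz.elim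
  · rw [← spectrum_complexMatrix (Module.finBasis ℝ V) B] at hne h
    obtain ⟨z, hz, hzr⟩ := spectrum.exists_nnnorm_eq_spectralRadius_of_nonempty hne
    have hz' := h z hz
    rw [realSpectralRadius, ← spectralRadius_complexMatrix (Module.finBasis ℝ V) B, ← hzr]
    simpa using hz'

/-- Gelfand's formula: ‖a^m‖^(1/m) tends to the spectral radius, so it eventually drops below `q`.
-/
theorem exists_norm_pow_le_of_spectralRadius_lt {A : Type*} [NormedRing A] [NormedAlgebra ℂ A]
    [CompleteSpace A] (a : A) {q : ℝ} (hq : spectralRadius ℂ a < ENNReal.ofReal q) :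
    ∃ m : ℕ, ‖a ^ m‖ ≤ q ^ m ∧ 1 ≤ m := by
  have hq0 : 0 < q := by
    by_contra hc
    rw [ENNReal.ofReal_of_nonpos (not_lt.1 hc)] at hq
    exact not_lt_bot hq
  have h := (spectrum.pow_nnnorm_pow_one_div_tendsto_nhds_spectralRadius a).eventually
    (gt_mem_nhds hq)
  obtain ⟨m, hm, hm1⟩ := (h.and (eventually_ge_atTop 1)).exists
  refine ⟨m, ?_, hm1⟩
  have hm0 : (0 : ℝ) < m := by exact_mod_cast hm1
  have h2 := ENNReal.rpow_le_rpow hm.le hm0.le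
  rw [← ENNReal.rpow_mul, one_div, inv_mul_cancel₀ hm0.ne', ENNReal.rpow_one,
    ENNReal.rpow_natCast, ← ENNReal.ofReal_pow hq0.le, ← enorm_eq_nnnorm,
    ← ofReal_norm] at h2
  exact (ENNReal.ofReal_le_ofReal_iff (by positivity)).1 h2

/-- A norm-like function which an operator contracts by any factor exceeding its spectral
radius. -/
theorem exists_adapted_norm {V : Type*} [NormedAddCommGroup V] [NormedSpace ℝ V]
    [FiniteDimensional ℝ V] (B : V →ₗ[ℝ] V) {q : ℝ} (hq : realSpectralRadius B < q) :
    ∃ (p : V → ℝ) (C : ℝ), 0 < C ∧ (∀ v w, p (v + w) ≤ p v + p w) ∧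
      (∀ v, p (B v) ≤ q * p v) ∧ (∀ v, ‖v‖ ≤ p v) ∧ ∀ v, p v ≤ C * ‖v‖ := by
  have hq0 : 0 < q := lt_of_le_of_lt ENNReal.toReal_nonneg hq
  let b := Module.finBasis ℝ V
  let M := complexMatrix b B
  obtain ⟨m, hm, hm1⟩ : ∃ m : ℕ, ‖M ^ m‖ ≤ q ^ m ∧ 1 ≤ m := by
    apply exists_norm_pow_le_of_spectralRadius_lt
    rw [spectralRadius_complexMatrix]
    exact (ENNReal.lt_ofReal_iff_toReal_lt (spectralRadius_baseChange_ne_top B)).2 hq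
  let c : V →ₗ[ℝ] (Fin (Module.finrank ℝ V) → ℂ) :=
    LinearMap.pi fun i => (Algebra.linearMap ℝ ℂ) ∘ₗ b.coord i
  have hcB : ∀ v, c (B v) = M.mulVec (c v) := by
    intro v
    have h1 := LinearMap.toMatrix_mulVec_repr b b B v
    ext i
    have h2 := congrFun h1 i
    simp only [c, M, complexMatrix, LinearMap.pi_apply, LinearMap.comp_apply,
      Algebra.linearMap_apply, Module.Basis.coord_apply]
    rw [← h2]
    simp [Matrix.mulVec, dotProduct]
  have hcBk : ∀ (k : ℕ) v, c ((B ^ k) v) = (M ^ k).mulVec (c v) := by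
    intro k
    induction k with
    | zero => intro v; simp
    | succ k ih =>
      intro v
      rw [pow_succ, Module.End.mul_apply, ih, hcB, Matrix.mulVec_mulVec, ← pow_succ]
  have hker : LinearMap.ker c = ⊥ := by
    rw [LinearMap.ker_eq_bot']
    intro v hv
    apply b.repr.injective
    ext i
    simpa [c] using congrFun hv i
  obtain ⟨K, hK0, hK⟩ := c.exists_antilipschitzWith hker
  have hK' : ∀ v, ‖v‖ ≤ K * ‖c v‖ := fun v => by
    simpa using ZeroHomClass.bound_of_antilipschitz c hK v
  let cc := LinearMap.toContinuousLinearMap c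
  have hcc : ∀ v, ‖c v‖ ≤ ‖cc‖ * ‖v‖ := fun v => cc.le_opNorm v
  -- The weights q⁻ᵏ make the sum shift by a factor `q` under `B`; the truncation at `m` is paid for
  -- by ‖M^m‖ ≤ q^m.
  let p : V → ℝ := fun v => K * ∑ k ∈ Finset.range m, (q⁻¹) ^ k * ‖c ((B ^ k) v)‖
  have hK0' : (0 : ℝ) < K := by exact_mod_cast hK0
  refine ⟨p, K * (∑ k ∈ Finset.range m, (q⁻¹) ^ k * ‖M ^ k‖ * ‖cc‖) + 1, ?_, ?_, ?_, ?_, ?_⟩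
  · positivity
  · intro v w
    simp only [p]
    rw [← mul_add, ← Finset.sum_add_distrib]
    gcongr with k
    rw [← mul_add, map_add, map_add]
    gcongr
    exact norm_add_le _ _
  · intro v
    simp only [p]
    rw [mul_left_comm]
    gcongr
    have e1 : ∀ k, q⁻¹ ^ k * ‖c ((B ^ k) (B v))‖ =
        q * (q⁻¹ ^ (k + 1) * ‖c ((B ^ (k + 1)) v)‖) := by
      intro k
      rw [pow_succ B, Module.End.mul_apply, pow_succ]
      field_simp
    simp only [e1]
    rw [← Finset.mul_sum]
    refine mul_le_mul_of_nonneg_left ?_ hq0.le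
    -- The shifted sum trades the term k = 0 for the term k = m, and `e4` says that the latter is no
    -- larger.
    have e2 := Finset.sum_range_succ' (fun k => q⁻¹ ^ k * ‖c ((B ^ k) v)‖) m
    have e3 := Finset.sum_range_succ (fun k => q⁻¹ ^ k * ‖c ((B ^ k) v)‖) m
    have e4 : q⁻¹ ^ m * ‖c ((B ^ m) v)‖ ≤ ‖c v‖ := by
      rw [hcBk, inv_pow, inv_mul_le_iff₀ (by positivity)]
      exact (Matrix.linfty_opNorm_mulVec _ _).trans (by gcongr)
    simp only [pow_zero, Module.End.one_apply, one_mul] at e2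
    linarith
  · intro v
    refine (hK' v).trans ?_
    simp only [p]
    gcongr
    have := Finset.single_le_sum (f := fun k => q⁻¹ ^ k * ‖c ((B ^ k) v)‖)
      (fun k _ => by positivity) (Finset.mem_range.2 hm1)
    simpa using this
  · intro v
    simp only [p]
    rw [add_mul, mul_assoc, Finset.sum_mul]
    have : K * ∑ k ∈ Finset.range m, q⁻¹ ^ k * ‖c ((B ^ k) v)‖ ≤
        K * ∑ k ∈ Finset.range m, q⁻¹ ^ k * ‖M ^ k‖ * ‖cc‖ * ‖v‖ := by
      refine mul_le_mul_of_nonneg_left (Finset.sum_le_sum fun k _ => ?_) hK0'.le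
      rw [hcBk, mul_assoc, mul_assoc]
      gcongr
      exact (Matrix.linfty_opNorm_mulVec _ _).trans (by gcongr; exact hcc v)
    linarith [norm_nonneg v]

end NAG

/-! ### Root location for real quadratics and the optimal parameters -/

namespace NAG

theorem re_im_of_real_quadratic {c₁ c₂ : ℝ} {z : ℂ} (hz : z ^ 2 - c₁ * z + c₂ = 0) :
    z.re ^ 2 - z.im ^ 2 - c₁ * z.re + c₂ = 0 ∧ (z.im = 0 ∨ c₁ = 2 * z.re) := by
  have h1 := congrArg Complex.re hz
  have h2 := congrArg Complex.im hz
  simp [pow_two] at h1 h2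
  refine ⟨by linarith, ?_⟩
  have : z.im * (2 * z.re - c₁) = 0 := by linarith
  rcases mul_eq_zero.1 this with h | h
  · exact Or.inl h
  · exact Or.inr (by linarith)

/-- A real quadratic satisfying the stability conditions on the disc of radius `R` has its roots
in that disc. -/
theorem norm_root_le {c₁ c₂ R : ℝ} (hR : 0 < R) (h₂ : c₂ ≤ R ^ 2)
    (hp : 0 ≤ R ^ 2 - c₁ * R + c₂) (hm : 0 ≤ R ^ 2 + c₁ * R + c₂) {z : ℂ}
    (hz : z ^ 2 - c₁ * z + c₂ = 0) : ‖z‖ ≤ R := by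
  obtain ⟨h1, h | h⟩ := re_im_of_real_quadratic hz
  · have hn : ‖z‖ = |z.re| := by
      rw [← sq_eq_sq₀ (norm_nonneg _) (abs_nonneg _), Complex.sq_norm, Complex.normSq_apply,
        h, sq_abs]
      ring
    rw [hn, abs_le]
    rw [h] at h1
    constructor
    · by_contra hc
      push Not at hc
      nlinarith [mul_nonneg hm (neg_pos.2 (hc.trans (neg_neg_of_pos hR))).le,
        mul_pos (sub_pos.2 hc) hR]
    -- Multiplying p(R) ≥ 0 by the root x = z.re and eliminating c₁x gives (x - R)(c₂ - xR) ≥ 0, so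
    -- x > R would force c₂ ≥ xR > R². The previous case is its mirror image.
    · by_contra hc
      push Not at hc
      nlinarith [mul_nonneg hp (hR.trans hc).le, mul_pos (sub_pos.2 hc) hR]
  -- For a conjugate pair the constant term is |z|².
  · rw [← sq_le_sq₀ (norm_nonneg _) hR.le, Complex.sq_norm, Complex.normSq_apply]
    rw [h] at h1
    nlinarith

theorem norm_root_lt {c₁ c₂ R : ℝ} (hR : 0 < R) (h₂ : c₂ < R ^ 2)
    (hp : 0 < R ^ 2 - c₁ * R + c₂) (hm : 0 < R ^ 2 + c₁ * R + c₂) {z : ℂ}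
    (hz : z ^ 2 - c₁ * z + c₂ = 0) : ‖z‖ < R := by
  refine lt_of_le_of_ne (norm_root_le hR h₂.le hp.le hm.le hz) fun hn => ?_
  have hn2 : z.re ^ 2 + z.im ^ 2 = R ^ 2 := by
    rw [← hn, Complex.sq_norm, Complex.normSq_apply]
    ring
  obtain ⟨h1, h | h⟩ := re_im_of_real_quadratic hz
  · rw [h] at h1 hn2
    have h3 : (z.re - R) * (z.re + R) = 0 := by linarith
    rcases mul_eq_zero.1 h3 with h4 | h4
    · have : z.re = R := by linarith
      rw [this] at h1
      linarith
    · have : z.re = -R := by linarith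
      rw [this] at h1
      linarith
  · rw [h] at h1
    nlinarith

/-- If the roots of a real quadratic lie in the disc of radius `R`, the stability conditions
hold. -/
theorem coeff_bounds_of_norm_root_le {c₁ c₂ R : ℝ} (hR : 0 ≤ R)
    (h : ∀ z : ℂ, z ^ 2 - c₁ * z + c₂ = 0 → ‖z‖ ≤ R) :
    c₂ ≤ R ^ 2 ∧ 0 ≤ R ^ 2 - c₁ * R + c₂ ∧ 0 ≤ R ^ 2 + c₁ * R + c₂ ∧ (R = 0 → c₁ = 0) := by
  rcases le_total 0 (c₁ ^ 2 - 4 * c₂) with hd | hd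
  · set D := √(c₁ ^ 2 - 4 * c₂)
    have hD : D ^ 2 = c₁ ^ 2 - 4 * c₂ := Real.sq_sqrt hd
    have hr : ∀ r : ℝ, r ^ 2 - c₁ * r + c₂ = 0 → |r| ≤ R := by
      intro r hr
      have := h (r : ℂ) (by exact_mod_cast hr)
      simpa using this
    have h1 := abs_le.1 (hr ((c₁ + D) / 2) (by nlinarith))
    have h2 := abs_le.1 (hr ((c₁ - D) / 2) (by nlinarith))
    refine ⟨?_, ?_, ?_, ?_⟩
    · nlinarith
    · nlinarith [mul_nonneg (sub_nonneg.2 h1.2) (sub_nonneg.2 h2.2)]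
    · nlinarith [mul_nonneg (sub_nonneg.2 h1.1) (sub_nonneg.2 h2.1)]
    · intro h0
      rw [h0] at h1 h2
      linarith [h1.1, h1.2, h2.1, h2.2]
  · set D := √(-(c₁ ^ 2 - 4 * c₂))
    have hD : D ^ 2 = -(c₁ ^ 2 - 4 * c₂) := Real.sq_sqrt (by linarith)
    have h1 := h (⟨c₁ / 2, D / 2⟩ : ℂ) (by
      apply Complex.ext
      · simp [pow_two]; nlinarith
      · simp [pow_two]; ring)
    rw [← sq_le_sq₀ (norm_nonneg _) hR, Complex.sq_norm, Complex.normSq_apply] at h1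
    have h1' : c₂ ≤ R ^ 2 := by
      have : c₁ / 2 * (c₁ / 2) + D / 2 * (D / 2) = c₂ := by nlinarith
      linarith
    refine ⟨h1', ?_, ?_, ?_⟩
    · nlinarith [sq_nonneg (R - c₁ / 2)]
    · nlinarith [sq_nonneg (R + c₁ / 2)]
    · intro h0
      rw [h0] at h1'
      have : c₁ ^ 2 = 0 := by nlinarith [sq_nonneg c₁]
      exact pow_eq_zero_iff (two_ne_zero) |>.1 this

/-- At R = 1 the quadratic takes the value αh at 1, and at -1 the value 2(1+β) - αh(1+2β), whose
positivity is exactly the step-size restriction. -/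
theorem norm_root_lt_one {α β h L : ℝ} (hβ : β ∈ Ico (0 : ℝ) 1) (hh : 0 < h) (hhL : h ≤ L)
    (hα : α ∈ Ioo (0 : ℝ) (2 * (β + 1) / (L * (2 * β + 1)))) {z : ℂ}
    (hz : z ^ 2 - ((1 + β) * (1 - α * h) : ℝ) * z + (β * (1 - α * h) : ℝ) = 0) : ‖z‖ < 1 := by
  obtain ⟨hβ0, hβ1⟩ := hβ
  obtain ⟨hα0, hα1⟩ := hα
  have hL : 0 < L := hh.trans_le hhL
  rw [lt_div_iff₀ (by positivity)] at hα1
  have hαh : 0 < α * h := mul_pos hα0 hh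
  have h1 : α * h * (2 * β + 1) ≤ α * (L * (2 * β + 1)) := by
    rw [mul_assoc]
    gcongr
  refine norm_root_lt one_pos ?_ ?_ ?_ hz <;> nlinarith

/-- With X = αL and Y = αμ: the condition at -ρ bounds X above, while the condition at ρ and the one
on the constant term bound Y below. Eliminating β leaves a bound on the ratio of X to Y; the
extremal choice is β = ρ/(2-ρ), where the quadratic for μ has ρ as a double root and that for L has
the root -ρ. -/
theorem rate_inequality {X Y β ρ : ℝ} (hX : 0 ≤ X) (hβ0 : 0 ≤ β)
    (hρ0 : 0 ≤ ρ) (hρ1 : ρ < 1)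
    (hL : 0 ≤ ρ ^ 2 + (1 + β) * (1 - X) * ρ + β * (1 - X))
    (hμ : 0 ≤ ρ ^ 2 - (1 + β) * (1 - Y) * ρ + β * (1 - Y))
    (hμ₂ : β * (1 - Y) ≤ ρ ^ 2)
    (h0 : ρ = 0 → X = 1 ∧ Y = 1) :
    3 * X * (1 - ρ) ^ 2 ≤ (1 + ρ) * (3 - ρ) * Y := by
  rcases hρ0.eq_or_lt with hρ | hρ
  · obtain ⟨rfl, rfl⟩ := h0 hρ.symm
    rw [← hρ]
    norm_num
  have hD : 0 < (1 + β) * ρ + β := by positivity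
  have hXD : X * ((1 + β) * ρ + β) ≤ (1 + ρ) * (ρ + β) := by nlinarith
  -- The two lower bounds for Y agree at (2-ρ)β = ρ. On either side one of them suffices, and the
  -- difference of the sides of `hpoly` contains the factor ±(ρ - (2-ρ)β).
  rcases le_total ((2 - ρ) * β) ρ with hc | hc
  · have hA : 0 < ρ - (1 - ρ) * β := by
      nlinarith
    have hYA : (1 - ρ) * (ρ - β) ≤ Y * (ρ - (1 - ρ) * β) := by nlinarith
    have hpoly : 3 * (1 - ρ) * (ρ + β) * (ρ - (1 - ρ) * β) ≤
        (3 - ρ) * ((1 + β) * ρ + β) * (ρ - β) := by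
      nlinarith [mul_nonneg hρ.le (mul_nonneg (sub_nonneg.2 hc)
        (by positivity : 0 ≤ ρ + 2 * β))]
    refine le_of_mul_le_mul_right ?_ (mul_pos hD hA)
    calc 3 * X * (1 - ρ) ^ 2 * (((1 + β) * ρ + β) * (ρ - (1 - ρ) * β))
        = (X * ((1 + β) * ρ + β)) * (3 * (1 - ρ) ^ 2 * (ρ - (1 - ρ) * β)) := by ring
      _ ≤ ((1 + ρ) * (ρ + β)) * (3 * (1 - ρ) ^ 2 * (ρ - (1 - ρ) * β)) := by gcongr
      _ = (3 * (1 - ρ) * (ρ + β) * (ρ - (1 - ρ) * β)) * ((1 + ρ) * (1 - ρ)) := by ring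
      _ ≤ ((3 - ρ) * ((1 + β) * ρ + β) * (ρ - β)) * ((1 + ρ) * (1 - ρ)) :=
        mul_le_mul_of_nonneg_right hpoly (mul_nonneg (by linarith) (by linarith))
      _ = ((1 - ρ) * (ρ - β)) * ((1 + ρ) * (3 - ρ) * ((1 + β) * ρ + β)) := by ring
      _ ≤ (Y * (ρ - (1 - ρ) * β)) * ((1 + ρ) * (3 - ρ) * ((1 + β) * ρ + β)) :=
        mul_le_mul_of_nonneg_right hYA
          (mul_nonneg (mul_nonneg (by linarith) (by linarith)) hD.le)
      _ = _ := by ring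
  · have hβ : 0 < β := by
      by_contra hb
      nlinarith
    have hYA : β - ρ ^ 2 ≤ Y * β := by linarith
    have hpoly : 3 * (1 - ρ) ^ 2 * (ρ + β) * β ≤
        (3 - ρ) * ((1 + β) * ρ + β) * (β - ρ ^ 2) := by
      have h3 : 0 ≤ 4 * ρ * β + (3 - ρ) * ρ ^ 2 := by
        have : 0 ≤ (3 - ρ) * ρ ^ 2 := mul_nonneg (by linarith) (sq_nonneg _)
        positivity
      nlinarith [mul_nonneg (sub_nonneg.2 hc) h3]
    refine le_of_mul_le_mul_right ?_ (mul_pos hD hβ)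
    calc 3 * X * (1 - ρ) ^ 2 * (((1 + β) * ρ + β) * β)
        = (X * ((1 + β) * ρ + β)) * (3 * (1 - ρ) ^ 2 * β) := by ring
      _ ≤ ((1 + ρ) * (ρ + β)) * (3 * (1 - ρ) ^ 2 * β) := by gcongr
      _ = (3 * (1 - ρ) ^ 2 * (ρ + β) * β) * (1 + ρ) := by ring
      _ ≤ ((3 - ρ) * ((1 + β) * ρ + β) * (β - ρ ^ 2)) * (1 + ρ) := by gcongr
      _ = (β - ρ ^ 2) * ((1 + ρ) * (3 - ρ) * ((1 + β) * ρ + β)) := by ring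
      _ ≤ (Y * β) * ((1 + ρ) * (3 - ρ) * ((1 + β) * ρ + β)) :=
        mul_le_mul_of_nonneg_right hYA
          (mul_nonneg (mul_nonneg (by linarith) (by linarith)) hD.le)
      _ = _ := by ring

theorem rhoOpt_le_of_roots {L μ α β ρ : ℝ} (hμ : 0 < μ) (hμL : μ ≤ L)
    (hβ : β ∈ Ico (0 : ℝ) 1) (hα : 0 < α) (hρ : 0 ≤ ρ)
    (hrμ : ∀ z : ℂ, z ^ 2 - ((1 + β) * (1 - α * μ) : ℝ) * z + (β * (1 - α * μ) : ℝ) = 0 →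
      ‖z‖ ≤ ρ)
    (hrL : ∀ z : ℂ, z ^ 2 - ((1 + β) * (1 - α * L) : ℝ) * z + (β * (1 - α * L) : ℝ) = 0 →
      ‖z‖ ≤ ρ) :
    rhoOpt L μ ≤ ρ := by
  have hβ0 := hβ.1
  have hL : 0 < L := hμ.trans_le hμL
  have hs : 0 < √(3 * L + μ) := Real.sqrt_pos.2 (by positivity)
  rw [rhoOpt, div_le_iff₀ hs]
  rcases le_or_gt 1 ρ with h1 | h1
  · nlinarith [Real.sqrt_nonneg μ]
  obtain ⟨m1, m2, -, m0⟩ := coeff_bounds_of_norm_root_le hρ hrμ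
  obtain ⟨-, -, l3, l0⟩ := coeff_bounds_of_norm_root_le hρ hrL
  have key := rate_inequality (X := α * L) (Y := α * μ) (by positivity) hβ0 hρ h1 l3 m2 m1
    (fun h0 => by
      have h2 := l0 h0
      have h3 := m0 h0
      have h4 : (1 + β) ≠ 0 := by positivity
      have h5 := (mul_eq_zero.1 h2).resolve_left h4
      have h6 := (mul_eq_zero.1 h3).resolve_left h4
      exact ⟨by linarith, by linarith⟩)
  -- Uses (1+ρ)(3-ρ) = 4 - (1-ρ)².
  have key2 : (1 - ρ) ^ 2 * (3 * L + μ) ≤ 4 * μ := by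
    refine le_of_mul_le_mul_left ?_ hα
    nlinarith
  have key3 : (1 - ρ) * √(3 * L + μ) ≤ 2 * √μ := by
    refine abs_le_of_sq_le_sq' ?_ (by positivity) |>.2
    rw [mul_pow, mul_pow, Real.sq_sqrt (by positivity), Real.sq_sqrt hμ.le]
    linarith
  linarith

theorem two_sqrt_le_sqrt {L μ : ℝ} (hμ : 0 < μ) (hμL : μ ≤ L) : 2 * √μ ≤ √(3 * L + μ) := by
  refine Real.le_sqrt_of_sq_le ?_
  rw [mul_pow, Real.sq_sqrt hμ.le]
  linarith

theorem betaOpt_mem {L μ : ℝ} (hμ : 0 < μ) (hμL : μ ≤ L) : betaOpt L μ ∈ Ico (0 : ℝ) 1 := by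
  have h1 := two_sqrt_le_sqrt hμ hμL
  have h2 := Real.sqrt_pos.2 hμ
  have h3 : 0 < √(3 * L + μ) := by linarith
  constructor
  · exact div_nonneg (by linarith) (by positivity)
  · rw [betaOpt, div_lt_one (by positivity)]
    linarith

theorem rhoOpt_nonneg {L μ : ℝ} (hμ : 0 < μ) (hμL : μ ≤ L) : 0 ≤ rhoOpt L μ :=
  div_nonneg (by linarith [two_sqrt_le_sqrt hμ hμL]) (Real.sqrt_nonneg _)

/-- Needed because the tangential block may contribute the eigenvalue β. -/
theorem betaOpt_le_rhoOpt {L μ : ℝ} (hμ : 0 < μ) (hμL : μ ≤ L) : betaOpt L μ ≤ rhoOpt L μ := by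
  have h1 := two_sqrt_le_sqrt hμ hμL
  have h2 := Real.sqrt_pos.2 hμ
  have h3 : 0 < √(3 * L + μ) := by linarith
  exact div_le_div_of_nonneg_left (by linarith) h3 (by linarith)

theorem alphaOpt_mem {L μ : ℝ} (hμ : 0 < μ) (hμL : μ ≤ L) :
    alphaOpt L μ ∈ Ioo (0 : ℝ) (2 * (betaOpt L μ + 1) / (L * (2 * betaOpt L μ + 1))) := by
  have hL : 0 < L := hμ.trans_le hμL
  refine ⟨by unfold alphaOpt; positivity, ?_⟩
  have h1 := two_sqrt_le_sqrt hμ hμL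
  have h2 := Real.sqrt_pos.2 hμ
  unfold alphaOpt betaOpt
  set s := √(3 * L + μ) with hs
  set m := √μ with hm
  have hs2 : s ^ 2 = 3 * L + μ := Real.sq_sqrt (by positivity)
  have hm2 : m ^ 2 = μ := Real.sq_sqrt hμ.le
  have h3 : 0 < s := by linarith
  have h4 : 0 < 3 * s - 2 * m := by linarith
  have e1 : 2 * ((s - 2 * m) / (s + 2 * m) + 1) / (L * (2 * ((s - 2 * m) / (s + 2 * m)) + 1)) =
      4 * s / (L * (3 * s - 2 * m)) := by
    have : (2 * ((s - 2 * m) / (s + 2 * m)) + 1) = (3 * s - 2 * m) / (s + 2 * m) := by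
      field_simp
      ring
    rw [this]
    field_simp
    ring
  rw [e1, div_lt_div_iff₀ (by positivity) (by positivity), ← hs2]
  have h5 : L * (3 * s - 2 * m) < s * (3 * L + μ) := by nlinarith [mul_pos h2 hL, mul_pos h3 hμ]
  rw [← hs2] at h5
  linarith

/-- The relation (1+β)ρ = 2β turns the values at ±ρ into ρ² - c₂ and ρ² + 3c₂, with c₂ = β(1-αh). So
all conditions reduce to -ρ²/3 ≤ c₂ ≤ ρ², and the optimal α places the endpoints at h = L and h = μ.
The case ρ = 0 means L = μ and is separate because the root criterion needs a positive radius. -/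
theorem norm_root_le_rhoOpt {L μ h : ℝ} (hμ : 0 < μ) (hμh : μ ≤ h) (hhL : h ≤ L) {z : ℂ}
    (hz : z ^ 2 - ((1 + betaOpt L μ) * (1 - alphaOpt L μ * h) : ℝ) * z +
      (betaOpt L μ * (1 - alphaOpt L μ * h) : ℝ) = 0) : ‖z‖ ≤ rhoOpt L μ := by
  have hμL := hμh.trans hhL
  have hL : 0 < L := hμ.trans_le hμL
  have h1 := two_sqrt_le_sqrt hμ hμL
  have h2 := Real.sqrt_pos.2 hμ
  have hs2 : √(3 * L + μ) ^ 2 = 3 * L + μ := Real.sq_sqrt (by positivity)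
  have hm2 : √μ ^ 2 = μ := Real.sq_sqrt hμ.le
  rcases (rhoOpt_nonneg hμ hμL).eq_or_lt with h0 | h0
  · have h3 : 0 < √(3 * L + μ) := by linarith
    have e1 : √(3 * L + μ) = 2 * √μ := by
      rw [rhoOpt, eq_comm, div_eq_zero_iff] at h0
      rcases h0 with h0 | h0 <;> linarith
    have e2 : L = μ := by
      rw [e1, mul_pow, hm2] at hs2
      linarith
    have e3 : h = μ := le_antisymm (e2 ▸ hhL) hμh
    have e4 : 1 - alphaOpt L μ * h = 0 := by
      rw [alphaOpt, e2, e3]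
      field_simp
      ring
    rw [e4] at hz
    have : z = 0 := by simpa using hz
    rw [this, norm_zero]
    exact rhoOpt_nonneg hμ hμL
  · have hβ := betaOpt_mem hμ hμL
    have hg : betaOpt L μ * (1 - alphaOpt L μ * h) ≤ rhoOpt L μ ^ 2 ∧
        -rhoOpt L μ ^ 2 ≤ 3 * (betaOpt L μ * (1 - alphaOpt L μ * h)) := by
      have hgu : 1 - alphaOpt L μ * h ≤ 3 * (L - μ) / (3 * L + μ) := by
        rw [alphaOpt, le_div_iff₀ (by positivity)]
        field_simp
        linarith
      have hgl : -((3 * (L - μ) / (3 * L + μ)) / 3) ≤ 1 - alphaOpt L μ * h := by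
        rw [alphaOpt]
        field_simp
        linarith
      have e : betaOpt L μ * (3 * (L - μ) / (3 * L + μ)) = rhoOpt L μ ^ 2 := by
        have h3 : 0 < √(3 * L + μ) := by linarith
        have e1 : 3 * (L - μ) = √(3 * L + μ) ^ 2 - (2 * √μ) ^ 2 := by
          rw [hs2, mul_pow, hm2]
          ring
        rw [e1, ← hs2, betaOpt, rhoOpt, Real.sqrt_sq h3.le]
        field_simp
        ring
      constructor
      · rw [← e]
        exact mul_le_mul_of_nonneg_left hgu hβ.1
      · rw [← e]
        have := mul_le_mul_of_nonneg_left hgl hβ.1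
        linarith
    have e5 : (1 + betaOpt L μ) * rhoOpt L μ = 2 * betaOpt L μ := by
      have h3 : 0 < √(3 * L + μ) := by linarith
      rw [betaOpt, rhoOpt]
      field_simp
      ring
    have e6 : (1 + betaOpt L μ) * (1 - alphaOpt L μ * h) * rhoOpt L μ =
        2 * (betaOpt L μ * (1 - alphaOpt L μ * h)) := by
      rw [mul_right_comm, e5]
      ring
    refine norm_root_le h0 hg.1 ?_ ?_ hz
    · rw [e6]
      linarith [hg.1]
    · rw [e6]
      linarith [hg.2]

end NAG

/-! ### The set of minimizers near `xs` and its tangent space -/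

namespace NAG

open InnerProductSpace in
theorem contDiff_gradient {d : ℕ} {f : Vec d → ℝ} (hf : ContDiff ℝ 2 f) :
    ContDiff ℝ 1 (gradient f) := by
  have h1 : ContDiff ℝ 1 (fderiv ℝ f) := hf.fderiv_right (by norm_num)
  exact (toDual ℝ (Vec d)).symm.contDiff.comp h1

theorem hasStrictFDerivAt_gradient {d : ℕ} {f : Vec d → ℝ} (hf : ContDiff ℝ 2 f) (x : Vec d) :
    HasStrictFDerivAt (gradient f) (fderiv ℝ (gradient f) x) x :=
  (contDiff_gradient hf).contDiffAt.hasStrictFDerivAt one_ne_zero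

open InnerProductSpace in
theorem inner_hessian {d : ℕ} {f : Vec d → ℝ} (hf : ContDiff ℝ 2 f) (x u v : Vec d) :
    inner ℝ (hessian f x u) v = fderiv ℝ (fderiv ℝ f) x u v := by
  have h1 : DifferentiableAt ℝ (fderiv ℝ f) x :=
    (hf.fderiv_right (m := 1) (by norm_num)).differentiable one_ne_zero x
  have h2 : HasFDerivAt (gradient f)
      (((toDual ℝ (Vec d)).symm.toContinuousLinearEquiv.toContinuousLinearMap :
        StrongDual ℝ (Vec d) →L[ℝ] Vec d).comp (fderiv ℝ (fderiv ℝ f) x)) x :=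
    ((toDual ℝ (Vec d)).symm.toContinuousLinearEquiv.toContinuousLinearMap.hasFDerivAt).comp x
      h1.hasFDerivAt
  have h3 : hessian f x u = (toDual ℝ (Vec d)).symm (fderiv ℝ (fderiv ℝ f) x u) := by
    rw [hessian, h2.fderiv]
    rfl
  rw [h3, toDual_symm_apply]

theorem hessian_isSymmetric {d : ℕ} {f : Vec d → ℝ} (hf : ContDiff ℝ 2 f) (x : Vec d) :
    (hessian f x).IsSymmetric := by
  intro u v
  rw [inner_hessian hf, real_inner_comm, inner_hessian hf]
  exact (hf.contDiffAt.isSymmSndFDerivAt (by simp)).eq u v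

theorem gradient_eq_zero_of_isLocalMin {d : ℕ} {f : Vec d → ℝ} {x : Vec d}
    (h : IsLocalMin f x) : gradient f x = 0 := by
  rw [gradient, h.fderiv_eq_zero, map_zero]

theorem hasFDerivAt_innerSL_gradient {d : ℕ} {f : Vec d → ℝ} (hf : ContDiff ℝ 2 f)
    (x : Vec d) : HasFDerivAt f (innerSL ℝ (gradient f x)) x :=
  ((hf.differentiable two_ne_zero) x).hasGradientAt.hasFDerivAt

theorem hasDerivAt_comp_line {d : ℕ} {f : Vec d → ℝ} (hf : ContDiff ℝ 2 f) (x v : Vec d)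
    (t : ℝ) : HasDerivAt (fun t : ℝ => f (x + t • v)) (inner ℝ (gradient f (x + t • v)) v) t := by
  have h1 : HasDerivAt (fun t : ℝ => x + t • v) v t := by
    simpa using ((hasDerivAt_id t).smul_const v).const_add x
  exact (hasFDerivAt_innerSL_gradient hf (x + t • v)).comp_hasDerivAt t h1

/-- Second-order necessary condition at a local minimum. -/
theorem inner_hessian_self_nonneg {d : ℕ} {f : Vec d → ℝ} (hf : ContDiff ℝ 2 f) {x : Vec d}
    (hmin : IsLocalMin f x) (v : Vec d) : 0 ≤ inner ℝ (hessian f x v) v := by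
  by_contra hc
  push Not at hc
  let φ : ℝ → ℝ := fun t => f (x + t • v)
  have hφ : deriv φ = fun t => inner ℝ (gradient f (x + t • v)) v :=
    funext fun t => (hasDerivAt_comp_line hf x v t).deriv
  have hline : HasDerivAt (fun t : ℝ => x + t • v) v 0 := by
    simpa using ((hasDerivAt_id (0 : ℝ)).smul_const v).const_add x
  have hφ2 : HasDerivAt (deriv φ) (inner ℝ (hessian f x v) v) 0 := by
    rw [hφ]
    have h1 : HasFDerivAt (gradient f) (fderiv ℝ (gradient f) x) (x + (0 : ℝ) • v) := by
      simpa using (hasStrictFDerivAt_gradient hf x).hasFDerivAt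
    have h2 := h1.comp_hasDerivAt (0 : ℝ) hline
    have h3 := h2.inner ℝ (hasDerivAt_const (0 : ℝ) v)
    simpa [hessian] using h3
  have hd0 : deriv φ 0 = 0 := by
    rw [hφ]
    simp [gradient_eq_zero_of_isLocalMin hmin]
  have hcont : ContinuousAt φ 0 := (hasDerivAt_comp_line hf x v 0).continuousAt
  have hmax : IsLocalMax φ 0 :=
    isLocalMax_of_deriv_deriv_neg (by rw [hφ2.deriv]; exact hc) hd0 hcont
  have hmin' : IsLocalMin φ 0 := by
    have ht : Tendsto (fun t : ℝ => x + t • v) (𝓝 0) (𝓝 x) := by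
      have := hline.continuousAt.tendsto
      simpa using this
    have := ht.eventually hmin
    filter_upwards [this] with t ht
    simpa [φ] using ht
  have hconst : φ =ᶠ[𝓝 0] fun _ => φ 0 := by
    filter_upwards [hmax, hmin'] with t h1 h2
    exact le_antisymm h1 h2
  have h4 : deriv φ =ᶠ[𝓝 0] fun _ => 0 := by
    simpa using hconst.deriv
  have h5 := h4.deriv_eq
  rw [hφ2.deriv] at h5
  simp at h5
  linarith

/-- A function bounded below whose gradient is `η`-Lipschitz near a critical point has its
squared gradient controlled by its values. -/
theorem sq_norm_gradient_le {E : Type*} [NormedAddCommGroup E] [InnerProductSpace ℝ E]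
    {φ : E → ℝ} {G : E → E} {r η c : ℝ} (hη : 0 < η)
    (hd : ∀ v ∈ Metric.ball (0 : E) r, HasFDerivAt φ (innerSL ℝ (G v)) v)
    (hlip : ∀ v ∈ Metric.ball (0 : E) r, ∀ w ∈ Metric.ball (0 : E) r,
      ‖G v - G w‖ ≤ η * ‖v - w‖)
    (h0 : G 0 = 0) (hlow : ∀ v ∈ Metric.ball (0 : E) r, c ≤ φ v) {v : E}
    (hv : v ∈ Metric.ball (0 : E) (r / 2)) : ‖G v‖ ^ 2 ≤ 4 * η * (φ v - c) := by
  rw [mem_ball_zero_iff] at hv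
  have hr : 0 < r := by linarith [norm_nonneg v]
  have hvr : v ∈ Metric.ball (0 : E) r := by
    rw [mem_ball_zero_iff]
    linarith
  -- The mean value bound costs η‖w - v‖², and this step length minimizes the resulting upper bound
  -- for φ(w). It also gives ‖w - v‖ ≤ ‖v‖/2, so `w` stays in the ball.
  set w := v - (2 * η)⁻¹ • G v with hw
  have hGv : ‖G v‖ ≤ η * ‖v‖ := by
    simpa [h0] using hlip v hvr 0 (Metric.mem_ball_self hr)
  have hwv : ‖w - v‖ = (2 * η)⁻¹ * ‖G v‖ := by
    rw [hw, sub_sub_cancel_left, norm_neg, norm_smul, Real.norm_of_nonneg (by positivity)]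
  have hwr : w ∈ Metric.ball (0 : E) r := by
    rw [mem_ball_zero_iff]
    have h1 : ‖w‖ ≤ ‖w - v‖ + ‖v‖ := by simpa using norm_add_le (w - v) v
    have h2 : (2 * η)⁻¹ * ‖G v‖ ≤ (2 * η)⁻¹ * (η * ‖v‖) := by gcongr
    have h3 : (2 * η)⁻¹ * (η * ‖v‖) = ‖v‖ / 2 := by field_simp
    linarith
  have hseg : segment ℝ v w ⊆ Metric.ball (0 : E) r :=
    (convex_ball (0 : E) r).segment_subset hvr hwr
  have hmvt := (convex_segment v w).norm_image_sub_le_of_norm_hasFDerivWithin_le'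
    (f := φ) (f' := fun y => innerSL ℝ (G y)) (φ := innerSL ℝ (G v)) (C := η * ‖w - v‖)
    (fun y hy => (hd y (hseg hy)).hasFDerivWithinAt)
    (fun y hy => by
      rw [← map_sub, innerSL_apply_norm]
      refine (hlip y (hseg hy) v hvr).trans ?_
      gcongr
      exact norm_sub_le_of_mem_segment hy)
    (left_mem_segment ℝ v w) (right_mem_segment ℝ v w)
  have hin : innerSL ℝ (G v) (w - v) = -((2 * η)⁻¹ * ‖G v‖ ^ 2) := by
    rw [hw, sub_sub_cancel_left, map_neg, map_smul, innerSL_apply_apply,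
      real_inner_self_eq_norm_sq, smul_eq_mul]
  rw [hin, hwv, Real.norm_eq_abs] at hmvt
  have h4 := (abs_le.1 hmvt).2
  have h5 := hlow w hwr
  have h6 : η * ((2 * η)⁻¹ * ‖G v‖) * ((2 * η)⁻¹ * ‖G v‖) = ‖G v‖ ^ 2 / (4 * η) := by
    field_simp
    ring
  have h7 : (2 * η)⁻¹ * ‖G v‖ ^ 2 = 2 * (‖G v‖ ^ 2 / (4 * η)) := by
    field_simp
    ring
  have h8 : ‖G v‖ ^ 2 / (4 * η) ≤ φ v - c := by
    rw [h6, h7] at h4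
    linarith
  rw [div_le_iff₀ (by positivity)] at h8
  linarith

theorem hessian_mem_orthogonal_ker {d : ℕ} {f : Vec d → ℝ} (hf : ContDiff ℝ 2 f)
    (x u : Vec d) : hessian f x u ∈ (LinearMap.ker (hessian f x))ᗮ := by
  intro k hk
  rw [← hessian_isSymmetric hf, LinearMap.mem_ker.1 hk, inner_zero_left]

/-- The zero set of the normal component of the gradient, parametrized over the kernel of the
Hessian. -/
theorem exists_normal_critical_parametrization {d : ℕ} {f : Vec d → ℝ} (hf : ContDiff ℝ 2 f)
    {xs : Vec d} (hg : gradient f xs = 0) :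
    ∃ Ψ : Vec d → Vec d, Ψ 0 = xs ∧ ContDiffAt ℝ 1 Ψ 0 ∧
      (∀ k ∈ LinearMap.ker (hessian f xs), fderiv ℝ Ψ 0 k = k) ∧
      ∀ᶠ k in 𝓝 0, k ∈ LinearMap.ker (hessian f xs) →
        (LinearMap.ker (hessian f xs)).starProjection (Ψ k - xs) = k ∧
        gradient f (Ψ k) ∈ LinearMap.ker (hessian f xs) := by
  set K := LinearMap.ker (hessian f xs) with hK
  set H := fderiv ℝ (gradient f) xs with hH
  let P := K.starProjection
  have hPH : ∀ u, P (H u) = 0 := fun u =>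
    (Submodule.starProjection_apply_eq_zero_iff K).2 (hessian_mem_orthogonal_ker hf xs u)
  have hPP : ∀ u, P (P u) = P u := fun u =>
    Submodule.starProjection_eq_self_iff.2 (K.starProjection_apply_mem u)
  -- Lyapunov–Schmidt reduction: Φ records the kernel coordinate and the normal part of the
  -- gradient. Its derivative P + H is injective since H maps into the complement of its kernel, and
  -- Ψ is the local inverse of Φ.
  let Φ : Vec d → Vec d := fun x => P (x - xs) + (gradient f x - P (gradient f x))
  have hΦs : Φ xs = 0 := by simp [Φ, hg]
  have hΦc : ContDiffAt ℝ 1 Φ xs := by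
    have h1 := contDiff_gradient hf
    apply ContDiff.contDiffAt
    exact (P.contDiff.comp (contDiff_id.sub contDiff_const)).add
      (h1.sub (P.contDiff.comp h1))
  have hinj : Function.Injective ((P + H : Vec d →L[ℝ] Vec d) : Vec d →ₗ[ℝ] Vec d) := by
    rw [← LinearMap.ker_eq_bot, LinearMap.ker_eq_bot']
    intro u hu
    have hu' : P u + H u = 0 := hu
    have h1 : P u = 0 := by
      have := congrArg P hu'
      simpa [hPP, hPH] using this
    have h2 : u ∈ K := by
      rw [h1, zero_add] at hu'
      exact hu'
    rw [← Submodule.starProjection_eq_self_iff.2 h2]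
    exact h1
  let A : Vec d ≃L[ℝ] Vec d := (LinearEquiv.ofInjectiveEndo _ hinj).toContinuousLinearEquiv
  have hA : ∀ u, A u = P u + H u := fun u => rfl
  have hΦd : HasFDerivAt Φ (A : Vec d →L[ℝ] Vec d) xs := by
    have h1 := (hasStrictFDerivAt_gradient hf xs).hasFDerivAt
    have h2 : HasFDerivAt Φ (P.comp (ContinuousLinearMap.id ℝ (Vec d)) + (H - P.comp H)) xs :=
      (P.hasFDerivAt.comp xs ((hasFDerivAt_id xs).sub_const xs)).add
        (h1.sub (P.hasFDerivAt.comp xs h1))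
    refine h2.congr_fderiv (ContinuousLinearMap.ext fun u => ?_)
    simp [hA, hPH]
  let Ψ := hΦc.localInverse hΦd one_ne_zero
  have hst := hΦc.hasStrictFDerivAt' hΦd one_ne_zero
  have hΨd : HasStrictFDerivAt Ψ (A.symm : Vec d →L[ℝ] Vec d) 0 := by
    have := hst.to_localInverse
    rwa [hΦs] at this
  have hΨr : ∀ᶠ k in 𝓝 0, Φ (Ψ k) = k := by
    have := hst.eventually_right_inverse
    rwa [hΦs] at this
  refine ⟨Ψ, ?_, ?_, ?_, ?_⟩
  · have := hΦc.localInverse_apply_image hΦd one_ne_zero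
    rwa [hΦs] at this
  · have := hΦc.to_localInverse hΦd one_ne_zero
    rwa [hΦs] at this
  · intro k hk
    rw [hΨd.hasFDerivAt.fderiv]
    have hAk : A k = k := by
      have : H k = 0 := hk
      rw [hA, this, add_zero]
      exact Submodule.starProjection_eq_self_iff.2 hk
    exact (A.symm_apply_eq).2 hAk.symm
  · filter_upwards [hΨr] with k hk hkK
    have hPk : P k = k := Submodule.starProjection_eq_self_iff.2 hkK
    have hk' : P (Ψ k - xs) + (gradient f (Ψ k) - P (gradient f (Ψ k))) = k := hk
    have h1 : P (Ψ k - xs) = k := by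
      have h2 := congrArg P hk'
      rw [map_add, hPP, map_sub P (gradient f (Ψ k)), hPP, sub_self, add_zero, hPk] at h2
      exact h2
    refine ⟨h1, ?_⟩
    rw [h1, add_eq_left, sub_eq_zero] at hk'
    exact Submodule.starProjection_eq_self_iff.1 hk'.symm

/-- Under the Polyak–Łojasiewicz condition the minimizers near `xs` are parametrized over the
kernel of the Hessian. -/
theorem exists_minSet_parametrization {d : ℕ} {f : Vec d → ℝ} (hf : ContDiff ℝ 2 f)
    {xs : Vec d} (hmin : IsLocalMin f xs) (hPL : LocalPL f xs) :
    ∃ Ψ : Vec d → Vec d, Ψ 0 = xs ∧ ContDiffAt ℝ 1 Ψ 0 ∧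
      (∀ k ∈ LinearMap.ker (hessian f xs), fderiv ℝ Ψ 0 k = k) ∧
      ∀ᶠ k in 𝓝 0, k ∈ LinearMap.ker (hessian f xs) →
        (LinearMap.ker (hessian f xs)).starProjection (Ψ k - xs) = k ∧ Ψ k ∈ minSet f xs := by
  obtain ⟨Ψ, hΨ0, hΨc, hΨd, hΨ⟩ := exists_normal_critical_parametrization hf
    (gradient_eq_zero_of_isLocalMin hmin)
  refine ⟨Ψ, hΨ0, hΨc, hΨd, ?_⟩
  set K := LinearMap.ker (hessian f xs) with hK
  let P := K.starProjection
  have hPmem : ∀ u, P u ∈ K := fun u => K.starProjection_apply_mem u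
  have hPself : ∀ {u}, u ∈ K → P u = u := fun h => Submodule.starProjection_eq_self_iff.2 h
  have hPt : Tendsto P (𝓝 0) (𝓝 0) := by simpa using P.continuous.tendsto 0
  have hΨt : Tendsto Ψ (𝓝 0) (𝓝 xs) := by simpa [hΨ0] using hΨc.continuousAt.tendsto
  have hΨPt : Tendsto (fun v => Ψ (P v)) (𝓝 0) (𝓝 xs) := hΨt.comp hPt
  obtain ⟨U, hUo, hxU, ν, hν, hPLU⟩ := hPL
  -- Composing with P spreads the parametrization over the whole space, so that φ can be studied on
  -- an open ball.
  let φ : Vec d → ℝ := fun v => f (Ψ (P v))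
  let G : Vec d → Vec d := fun v => gradient f (Ψ (P v))
  have hΨP : ∀ᶠ v in 𝓝 0, P (Ψ (P v) - xs) = P v ∧ G v ∈ K :=
    (hPt.eventually hΨ).mono fun v hv => hv (hPmem v)
  -- The gradient of φ is G itself: G takes values in the kernel, and P ∘ DΨ ∘ P = P because Ψ is a
  -- graph over the kernel.
  have hφd : ∀ᶠ v in 𝓝 0, HasFDerivAt φ (innerSL ℝ (G v)) v := by
    have hdiff : ∀ᶠ v in 𝓝 0, DifferentiableAt ℝ Ψ (P v) := by
      have h1 := hΨc.eventually (by simp)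
      exact (hPt.eventually h1).mono fun v hv => hv.differentiableAt one_ne_zero
    filter_upwards [hdiff, hΨP.eventually_nhds] with v hv hev
    have h1 : HasFDerivAt (fun v => Ψ (P v)) ((fderiv ℝ Ψ (P v)).comp P) v :=
      hv.hasFDerivAt.comp v P.hasFDerivAt
    have h2 : HasFDerivAt φ ((innerSL ℝ (G v)).comp ((fderiv ℝ Ψ (P v)).comp P)) v :=
      (hasFDerivAt_innerSL_gradient hf (Ψ (P v))).comp v h1
    have h3 : P.comp ((fderiv ℝ Ψ (P v)).comp P) = P := by
      have h4 : HasFDerivAt (fun v => P (Ψ (P v) - xs))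
          (P.comp ((fderiv ℝ Ψ (P v)).comp P)) v :=
        P.hasFDerivAt.comp v (h1.sub_const xs)
      have h5 : (fun v => P (Ψ (P v) - xs)) =ᶠ[𝓝 v] P := hev.mono fun w hw => hw.1
      exact (h4.congr_of_eventuallyEq h5.symm).unique P.hasFDerivAt
    convert h2 using 1
    ext1 u
    have hGP : P (G v) = G v := hPself hev.self_of_nhds.2
    have h6 : P (fderiv ℝ Ψ (P v) (P u)) = P u := congrArg (fun T : Vec d →L[ℝ] Vec d => T u) h3
    change inner ℝ (G v) u = inner ℝ (G v) (fderiv ℝ Ψ (P v) (P u))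
    calc inner ℝ (G v) u = inner ℝ (P (G v)) u := by rw [hGP]
      _ = inner ℝ (G v) (P u) := K.inner_starProjection_left_eq_right _ _
      _ = inner ℝ (G v) (P (fderiv ℝ Ψ (P v) (P u))) := by rw [h6]
      _ = inner ℝ (P (G v)) (fderiv ℝ Ψ (P v) (P u)) :=
        (K.inner_starProjection_left_eq_right _ _).symm
      _ = _ := by rw [hGP]
  -- DΨ(0) fixes the kernel, which the Hessian annihilates; the vanishing strict derivative makes G
  -- Lipschitz near 0 with any prescribed constant.
  have hGd : HasStrictFDerivAt G (0 : Vec d →L[ℝ] Vec d) 0 := by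
    have h1 : HasStrictFDerivAt Ψ (fderiv ℝ Ψ 0) (P 0) := by
      rw [map_zero]
      exact hΨc.hasStrictFDerivAt one_ne_zero
    have h2 : HasStrictFDerivAt (gradient f) (fderiv ℝ (gradient f) xs) (Ψ (P 0)) := by
      rw [map_zero, hΨ0]
      exact hasStrictFDerivAt_gradient hf xs
    have h3 := h2.comp (0 : Vec d) (h1.comp (0 : Vec d) P.hasStrictFDerivAt)
    refine h3.congr_fderiv (ContinuousLinearMap.ext fun u => ?_)
    have h4 : fderiv ℝ Ψ 0 (P u) = P u := hΨd _ (hPmem u)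
    have h5 : fderiv ℝ (gradient f) xs (P u) = 0 := hPmem u
    simp [h4, h5]
  -- With this η the descent bound reads ‖G‖² ≤ ν(φ - f(xs)), half of what the Polyak–Łojasiewicz
  -- inequality demands from below.
  have hη : 0 < ν / 4 := by positivity
  have hlip : ∀ᶠ z : Vec d × Vec d in 𝓝 (0, 0), ‖G z.1 - G z.2‖ ≤ ν / 4 * ‖z.1 - z.2‖ := by
    have := hGd.isLittleO.def hη
    simpa using this
  rw [nhds_prod_eq] at hlip
  obtain ⟨s, hs, hlip⟩ := (eventually_prod_self_iff
    (r := fun v w => ‖G v - G w‖ ≤ ν / 4 * ‖v - w‖)).1 hlip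
  have hlow : ∀ᶠ v in 𝓝 0, f xs ≤ φ v := hΨPt.eventually hmin
  have hU : ∀ᶠ v in 𝓝 0, Ψ (P v) ∈ U := hΨPt.eventually (hUo.mem_nhds hxU)
  obtain ⟨r, hr, hball⟩ := Metric.eventually_nhds_iff_ball.1
    (((hφd.and (show ∀ᶠ v in 𝓝 0, v ∈ s from hs)).and hlow).and hU)
  have hG0 : G 0 = 0 := by
    simp [G, hΨ0, gradient_eq_zero_of_isLocalMin hmin]
  have hconst : ∀ v ∈ Metric.ball (0 : Vec d) (r / 2), φ v = f xs := by
    intro v hv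
    have h1 := sq_norm_gradient_le hη (fun v hv => (hball v hv).1.1.1)
      (fun v hv w hw => hlip v (hball v hv).1.1.2 w (hball w hw).1.1.2) hG0
      (fun v hv => (hball v hv).1.2) hv
    have hv' := hball v (Metric.ball_subset_ball (by linarith) hv)
    have h2 := hPLU _ hv'.2
    have h3 := hv'.1.2
    have h4 : 2 * ν * (φ v - f xs) ≤ 4 * (ν / 4) * (φ v - f xs) := h2.trans h1
    nlinarith
  have hmin2 : ∀ᶠ x in 𝓝 xs, ∀ᶠ y in 𝓝 x, f xs ≤ f y := eventually_eventually_nhds.2 hmin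
  filter_upwards [hΨ, Metric.ball_mem_nhds (0 : Vec d) (half_pos hr),
    hΨt.eventually hmin2] with k hk hkr hkm hkK
  have hfk : f (Ψ k) = f xs := by
    have := hconst k hkr
    simpa [φ, hPself hkK] using this
  refine ⟨(hk hkK).1, ?_, hfk⟩
  filter_upwards [hkm] with y hy
  rw [hfk]
  exact hy

/-- The tangent space of the set of minimizers is the kernel of the Hessian. -/
theorem tangentSpace_eq_ker {d : ℕ} {f : Vec d → ℝ} (hf : ContDiff ℝ 2 f)
    {xs : Vec d} (hmin : IsLocalMin f xs) (hPL : LocalPL f xs) :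
    tangentSpace f xs = LinearMap.ker (hessian f xs) := by
  apply le_antisymm
  · refine Submodule.span_le.2 ?_
    rintro w ⟨δ, γ, hδ, hγ, hγS, hγ0, rfl⟩
    have h0 : Ioo (-δ) δ ∈ 𝓝 (0 : ℝ) := Ioo_mem_nhds (by linarith) hδ
    have hγd : HasDerivAt γ (deriv γ 0) 0 :=
      ((hγ.contDiffAt h0).differentiableAt one_ne_zero).hasDerivAt
    have h1 : HasFDerivAt (gradient f) (fderiv ℝ (gradient f) xs) (γ 0) := by
      rw [hγ0]
      exact (hasStrictFDerivAt_gradient hf xs).hasFDerivAt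
    have h2 := h1.comp_hasDerivAt (0 : ℝ) hγd
    have h3 : (gradient f ∘ γ) =ᶠ[𝓝 0] fun _ => 0 := by
      filter_upwards [h0] with t ht
      exact gradient_eq_zero_of_isLocalMin (hγS t ht).1
    have h4 := (hasDerivAt_const (0 : ℝ) (0 : Vec d)).congr_of_eventuallyEq h3
    exact h2.unique h4
  · intro k hk
    obtain ⟨Ψ, hΨ0, hΨc, hΨd, hΨ⟩ := exists_minSet_parametrization hf hmin hPL
    refine Submodule.subset_span ?_
    have hl : HasDerivAt (fun t : ℝ => t • k) k 0 := by
      simpa using (hasDerivAt_id (0 : ℝ)).smul_const k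
    have ht : Tendsto (fun t : ℝ => t • k) (𝓝 0) (𝓝 0) := by
      simpa using hl.continuousAt.tendsto
    obtain ⟨δ, hδ, hball⟩ := Metric.eventually_nhds_iff_ball.1
      ((ht.eventually hΨ).and (ht.eventually (hΨc.eventually (by simp))))
    have hIoo : ∀ t ∈ Ioo (-δ) δ, t ∈ Metric.ball (0 : ℝ) δ := by
      intro t ht
      simpa [abs_lt] using ht
    refine ⟨δ, fun t => Ψ (t • k), hδ, ?_, ?_, by simpa using hΨ0, ?_⟩
    · intro t ht
      exact ((hball t (hIoo t ht)).2.comp t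
        (contDiff_id.smul contDiff_const).contDiffAt).contDiffWithinAt
    · intro t ht
      exact ((hball t (hIoo t ht)).1 (Submodule.smul_mem _ _ hk)).2
    · have h1 : HasFDerivAt Ψ (fderiv ℝ Ψ 0) ((0 : ℝ) • k) := by
        rw [zero_smul]
        exact (hΨc.differentiableAt one_ne_zero).hasFDerivAt
      refine (h1.comp_hasDerivAt (0 : ℝ) hl).deriv.trans ?_
      exact hΨd k hk

/-- If the kernel were everything, the parametrization would be k ↦ xs + k, and all nearby points
would be minimizers at the same level. This makes N nontrivial, so μ and L are genuine eigenvalues.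
-/
theorem ker_hessian_ne_top {d : ℕ} {f : Vec d → ℝ} (hf : ContDiff ℝ 2 f)
    {xs : Vec d} (hmin : IsLocalMin f xs) (hPL : LocalPL f xs)
    (hnc : ¬ ∀ᶠ x in 𝓝 xs, f x = f xs) : LinearMap.ker (hessian f xs) ≠ ⊤ := by
  intro htop
  apply hnc
  obtain ⟨Ψ, -, -, -, hΨ⟩ := exists_minSet_parametrization hf hmin hPL
  have ht : Tendsto (fun x => x - xs) (𝓝 xs) (𝓝 0) := by
    have : ContinuousAt (fun x => x - xs) xs := by fun_prop
    simpa [ContinuousAt] using this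
  filter_upwards [ht.eventually hΨ] with x hx
  obtain ⟨h1, h2⟩ := hx (by rw [htop]; trivial)
  rw [Submodule.starProjection_eq_self_iff.2 (by rw [htop]; trivial)] at h1
  have : Ψ (x - xs) = x := sub_left_injective h1
  rw [this] at h2
  exact h2.2

end NAG

/-! ### Spectrum of the normal Hessian and of the block operator -/

namespace NAG

theorem coe_normalHessian {d : ℕ} {f : Vec d → ℝ} (hf : ContDiff ℝ 2 f) {xs : Vec d}
    (hT : tangentSpace f xs = LinearMap.ker (hessian f xs)) (v : normalSpace f xs) :
    (normalHessian f xs v : Vec d) = hessian f xs v := by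
  have hN : normalSpace f xs = (LinearMap.ker (hessian f xs))ᗮ :=
    congrArg Submodule.orthogonal hT
  have h1 : hessian f xs v ∈ normalSpace f xs := hN.ge (hessian_mem_orthogonal_ker hf xs v)
  exact Submodule.starProjection_eq_self_iff.2 h1

theorem normalHessian_isSymmetric {d : ℕ} {f : Vec d → ℝ} (hf : ContDiff ℝ 2 f) {xs : Vec d}
    (hT : tangentSpace f xs = LinearMap.ker (hessian f xs)) :
    (normalHessian f xs).IsSymmetric := by
  intro u v
  rw [Submodule.coe_inner, Submodule.coe_inner, coe_normalHessian hf hT,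
    coe_normalHessian hf hT]
  exact hessian_isSymmetric hf xs u v

/-- The second-order condition excludes negative eigenvalues; an eigenvector for 0 would lie in the
kernel, which is T, and be orthogonal to itself. -/
theorem pos_of_hasEigenvalue_normalHessian {d : ℕ} {f : Vec d → ℝ} (hf : ContDiff ℝ 2 f)
    {xs : Vec d} (hmin : IsLocalMin f xs)
    (hT : tangentSpace f xs = LinearMap.ker (hessian f xs)) {h : ℝ}
    (hh : Module.End.HasEigenvalue (normalHessian f xs) h) : 0 < h := by
  obtain ⟨v, hv⟩ := hh.exists_hasEigenvector
  have h1 : hessian f xs v = h • (v : Vec d) := by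
    rw [← coe_normalHessian hf hT, hv.apply_eq_smul]
    rfl
  have hv0 : (v : Vec d) ≠ 0 := fun h0 => hv.2 (Subtype.ext h0)
  have hvn : 0 < inner ℝ (v : Vec d) v := real_inner_self_pos.2 hv0
  have h2 := inner_hessian_self_nonneg hf hmin (v : Vec d)
  rw [h1, real_inner_smul_left] at h2
  refine lt_of_le_of_ne (nonneg_of_mul_nonneg_left h2 hvn) fun h0 => ?_
  rw [← h0, zero_smul] at h1
  have h3 : (v : Vec d) ∈ tangentSpace f xs := by
    rw [hT]
    exact h1
  exact hvn.ne' (v.2 _ h3)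

theorem finite_eigenvalues_normalHessian {d : ℕ} (f : Vec d → ℝ) (xs : Vec d) :
    {t : ℝ | Module.End.HasEigenvalue (normalHessian f xs) t}.Finite := by
  simp only [Module.End.hasEigenvalue_iff_mem_spectrum]
  exact Module.End.finite_spectrum (normalHessian f xs)

theorem nonempty_eigenvalues_normalHessian {d : ℕ} {f : Vec d → ℝ} (hf : ContDiff ℝ 2 f)
    {xs : Vec d} (hT : tangentSpace f xs = LinearMap.ker (hessian f xs))
    (hK : LinearMap.ker (hessian f xs) ≠ ⊤) :
    {t : ℝ | Module.End.HasEigenvalue (normalHessian f xs) t}.Nonempty := by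
  have : Nontrivial (normalSpace f xs) := by
    rw [Submodule.nontrivial_iff_ne_bot, normalSpace, hT, Ne, Submodule.orthogonal_eq_bot_iff]
    exact hK
  exact ⟨_, (normalHessian_isSymmetric hf hT).hasEigenvalue_iSup_of_finiteDimensional⟩

theorem inner_smul_normalSpace {d : ℕ} {f : Vec d → ℝ} {xs : Vec d} (v w : normalSpace f xs)
    (c : ℝ) : inner ℝ v (c • w) = c * inner ℝ v w :=
  real_inner_smul_right v w c

theorem inner_normalStep {d : ℕ} {f : Vec d → ℝ} (hf : ContDiff ℝ 2 f) {xs : Vec d}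
    (hT : tangentSpace f xs = LinearMap.ker (hessian f xs)) (α : ℝ) {h : ℝ}
    {v : normalSpace f xs} (hv : normalHessian f xs v = h • v) (p : normalSpace f xs) :
    inner ℝ v (normalStep f xs α p) = (1 - α * h) * inner ℝ v p := by
  rw [normalStep, LinearMap.sub_apply, LinearMap.smul_apply, LinearMap.id_apply,
    inner_sub_right, inner_smul_normalSpace, ← normalHessian_isSymmetric hf hT, hv,
    real_inner_comm p (h • v), inner_smul_normalSpace, real_inner_comm v p]
  ring

-- For an eigenvector v of the normal Hessian, (z v, v, 0) is an eigenvector of the block operator;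
-- the proof checks its real and imaginary parts.
open TensorProduct in
theorem mem_spectrum_blockOp_of_root {d : ℕ} {f : Vec d → ℝ} {xs : Vec d} {α β h : ℝ}
    (hh : Module.End.HasEigenvalue (normalHessian f xs) h) {z : ℂ}
    (hz : z ^ 2 - ((1 + β) * (1 - α * h) : ℝ) * z + (β * (1 - α * h) : ℝ) = 0) :
    z ∈ spectrum ℂ ((blockOp f xs α β).baseChange ℂ : Module.End ℂ (ℂ ⊗[ℝ] _)) := by
  obtain ⟨v, hv⟩ := hh.exists_hasEigenvector
  have hs : normalStep f xs α v = (1 - α * h) • v := by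
    rw [normalStep, LinearMap.sub_apply, LinearMap.smul_apply, LinearMap.id_apply,
      hv.apply_eq_smul, sub_smul, one_smul, mul_smul]
  have hre := congrArg Complex.re hz
  have him := congrArg Complex.im hz
  simp only [pow_two, Complex.add_re, Complex.sub_re, Complex.mul_re, Complex.ofReal_re,
    Complex.ofReal_im, Complex.zero_re, Complex.add_im, Complex.sub_im, Complex.mul_im,
    Complex.zero_im, zero_mul, sub_zero, add_zero] at hre him
  rw [mem_spectrum_baseChange_iff]
  refine ⟨(z.re • v, v, 0), (z.im • v, 0, 0), Or.inl ?_, ?_, ?_⟩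
  · intro h0
    exact hv.2 (congrArg (fun w => w.2.1) h0)
  · ext1
    · change (1 + β) • normalStep f xs α (z.re • v) - β • normalStep f xs α v =
        z.re • z.re • v - z.im • z.im • v
      rw [map_smul, hs]
      simp only [smul_smul, ← sub_smul]
      congr 1
      linarith
    · ext1
      · change z.re • v = z.re • v - z.im • (0 : normalSpace f xs)
        simp
      · change β • (0 : tangentSpace f xs) =
          z.re • (0 : tangentSpace f xs) - z.im • (0 : tangentSpace f xs)
        simp
  · ext1
    · change (1 + β) • normalStep f xs α (z.im • v) - β • normalStep f xs α 0 =
        z.im • z.re • v + z.re • z.im • v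
      rw [map_smul, hs, map_zero, smul_zero, sub_zero]
      simp only [smul_smul, ← add_smul]
      congr 1
      linarith
    · ext1
      · change z.im • v = z.im • v + z.re • (0 : normalSpace f xs)
        simp
      · change β • (0 : tangentSpace f xs) =
          z.im • (0 : tangentSpace f xs) + z.re • (0 : tangentSpace f xs)
        simp

-- An eigenvector (a, b, t) has a = z b and βt = z t. In an orthonormal eigenbasis on N, each
-- coordinate of b is annihilated by the value of the corresponding quadratic at z, so b and t both
-- vanish unless z is a root or equals β.
open TensorProduct in
theorem eq_or_root_of_mem_spectrum_blockOp {d : ℕ} {f : Vec d → ℝ} (hf : ContDiff ℝ 2 f)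
    {xs : Vec d} (hT : tangentSpace f xs = LinearMap.ker (hessian f xs)) {α β : ℝ} {z : ℂ}
    (hz : z ∈ spectrum ℂ ((blockOp f xs α β).baseChange ℂ : Module.End ℂ (ℂ ⊗[ℝ] _))) :
    z = β ∨ ∃ h : ℝ, Module.End.HasEigenvalue (normalHessian f xs) h ∧
      z ^ 2 - ((1 + β) * (1 - α * h) : ℝ) * z + (β * (1 - α * h) : ℝ) = 0 := by
  rw [mem_spectrum_baseChange_iff] at hz
  obtain ⟨⟨p₁, p₂, p₃⟩, ⟨q₁, q₂, q₃⟩, hne, hp, hq⟩ := hz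
  by_contra hc
  push Not at hc
  obtain ⟨hzβ, hroot⟩ := hc
  have hp1 : (1 + β) • normalStep f xs α p₁ - β • normalStep f xs α p₂ =
    z.re • p₁ - z.im • q₁ := congrArg (fun w => w.1) hp
  have hp2 : p₁ = z.re • p₂ - z.im • q₂ := congrArg (fun w => w.2.1) hp
  have hp3 : β • p₃ = z.re • p₃ - z.im • q₃ := congrArg (fun w => w.2.2) hp
  have hq1 : (1 + β) • normalStep f xs α q₁ - β • normalStep f xs α q₂ =
    z.im • p₁ + z.re • q₁ := congrArg (fun w => w.1) hq
  have hq2 : q₁ = z.im • p₂ + z.re • q₂ := congrArg (fun w => w.2.1) hq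
  have hq3 : β • q₃ = z.im • p₃ + z.re • q₃ := congrArg (fun w => w.2.2) hq
  have hsym := normalHessian_isSymmetric hf hT
  let b := hsym.eigenvectorBasis rfl
  have hcoord : ∀ i, inner ℝ (b i) p₂ = 0 ∧ inner ℝ (b i) q₂ = 0 := by
    intro i
    have hev := hsym.hasEigenvector_eigenvectorBasis rfl i
    set h : ℝ := hsym.eigenvalues rfl i
    have hbi : normalHessian f xs (b i) = h • b i := hev.apply_eq_smul
    have hr := hroot h (Module.End.hasEigenvalue_of_hasEigenvector hev)
    have e1 := congrArg (fun w => inner ℝ (b i) w) hp1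
    have e2 := congrArg (fun w => inner ℝ (b i) w) hp2
    have e3 := congrArg (fun w => inner ℝ (b i) w) hq1
    have e4 := congrArg (fun w => inner ℝ (b i) w) hq2
    simp only [inner_sub_right, inner_add_right, inner_smul_normalSpace,
      inner_normalStep hf hT α hbi] at e1 e2 e3 e4
    have key : (z ^ 2 - ((1 + β) * (1 - α * h) : ℝ) * z + (β * (1 - α * h) : ℝ)) *
        (⟨inner ℝ (b i) p₂, inner ℝ (b i) q₂⟩ : ℂ) = 0 := by
      rw [e2, e4] at e1 e3
      apply Complex.ext
      · simp only [pow_two, Complex.add_re, Complex.sub_re, Complex.mul_re, Complex.ofReal_re,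
          Complex.ofReal_im, Complex.zero_re, Complex.add_im, Complex.sub_im, Complex.mul_im]
        linarith
      · simp only [pow_two, Complex.add_re, Complex.sub_re, Complex.mul_re, Complex.ofReal_re,
          Complex.ofReal_im, Complex.zero_im, Complex.add_im, Complex.sub_im, Complex.mul_im]
        linarith
    have h0 := (mul_eq_zero.1 key).resolve_left hr
    exact ⟨congrArg Complex.re h0, congrArg Complex.im h0⟩
  have hp20 : p₂ = 0 := b.toBasis.repr.injective (Finsupp.ext fun i => by
    simpa [b.repr_apply_apply] using (hcoord i).1)
  have hq20 : q₂ = 0 := b.toBasis.repr.injective (Finsupp.ext fun i => by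
    simpa [b.repr_apply_apply] using (hcoord i).2)
  have hp10 : p₁ = 0 := by simpa [hp20, hq20] using hp2
  have hq10 : q₁ = 0 := by simpa [hp20, hq20] using hq2
  have hzn : (z.re - β) ^ 2 + z.im ^ 2 ≠ 0 := by
    intro h0
    apply hzβ
    have h1 : z.re - β = 0 := by nlinarith [sq_nonneg (z.re - β), sq_nonneg z.im]
    have h2 : z.im = 0 := by nlinarith [sq_nonneg (z.re - β), sq_nonneg z.im]
    apply Complex.ext
    · simp only [Complex.ofReal_re]
      linarith
    · simpa using h2
  have e1 : (z.re - β) • p₃ = z.im • q₃ := by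
    rw [sub_smul, hp3]
    abel
  have e2 : (z.re - β) • q₃ = -(z.im • p₃) := by
    rw [sub_smul, hq3]
    abel
  have hp30 : p₃ = 0 := by
    refine (smul_eq_zero.1 (?_ : ((z.re - β) ^ 2 + z.im ^ 2) • p₃ = 0)).resolve_left hzn
    rw [add_smul, pow_two, mul_smul, e1, smul_comm, e2, smul_neg, smul_smul, ← pow_two]
    simp
  have hq30 : q₃ = 0 := by
    refine (smul_eq_zero.1 (?_ : ((z.re - β) ^ 2 + z.im ^ 2) • q₃ = 0)).resolve_left hzn
    rw [add_smul, pow_two, mul_smul, e2, smul_neg, smul_comm, e1, smul_smul, ← pow_two]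
    simp
  subst hp10 hq10 hp20 hq20 hp30 hq30
  rcases hne with h | h <;> exact h rfl

end NAG

/-! ### Contraction towards a retract -/

namespace NAG

/-- Iterates of a map which contracts towards a Lipschitz retract of fixed points converge
linearly. -/
theorem exists_limit_of_contracts_to_retract {Z : Type*} [NormedAddCommGroup Z] [CompleteSpace Z]
    {F σ : Z → Z} {V : Z → ℝ} {z₀ : Z} {q D A B : ℝ} {K : NNReal} {s : Set Z}
    (hq0 : 0 ≤ q) (hq1 : q < 1) (hD : 0 ≤ D) (hA : 0 ≤ A) (hB : 0 ≤ B)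
    (hs : s ∈ 𝓝 z₀) (hσ : LipschitzOnWith K σ s) (hσ0 : σ z₀ = z₀)
    (hF : ContinuousAt F z₀) (hF0 : F z₀ = z₀) (hV : ∀ z, 0 ≤ V z)
    (hstep : ∀ᶠ z in 𝓝 z₀, V (F z) ≤ q * V z ∧ ‖σ (F z) - σ z‖ ≤ D * V z)
    (hup : ∀ᶠ z in 𝓝 z₀, ‖z - σ z‖ ≤ A * V z)
    (hlow : ∀ᶠ z in 𝓝 z₀, V z ≤ B * ‖z - σ z‖) {P : Z → Prop} (hP : ∀ᶠ z in 𝓝 z₀, P z) :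
    ∃ δ > 0, ∃ C > 0, ∀ z, ‖z - z₀‖ < δ → ∃ z', P z' ∧ σ z' = z' ∧
      Tendsto (fun n => F^[n] z) atTop (𝓝 z') ∧
      ∀ n : ℕ, ‖F^[n] z - z'‖ ≤ C * ‖z - z'‖ * q ^ n := by
  have hFt : Tendsto F (𝓝 z₀) (𝓝 z₀) := by simpa [ContinuousAt, hF0] using hF
  have hupF : ∀ᶠ z in 𝓝 z₀, ‖F z - σ (F z)‖ ≤ A * V (F z) := hFt.eventually hup
  obtain ⟨R, hR, hball⟩ := Metric.eventually_nhds_iff_ball.1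
    ((((hstep.and hup).and hlow).and hP).and (hupF.and (show ∀ᶠ z in 𝓝 z₀, z ∈ s from hs)))
  have hball' : ∀ z, ‖z - z₀‖ < R → _ := fun z hz => hball z (mem_ball_iff_norm.2 hz)
  have hσR : LipschitzOnWith K σ (Metric.ball z₀ R) := hσ.mono fun z hz => (hball z hz).2.2
  have hσK : ∀ z w, ‖z - z₀‖ < R → ‖w - z₀‖ < R → ‖σ z - σ w‖ ≤ K * ‖z - w‖ := by
    intro z w hz hw
    have := hσR.dist_le_mul z (mem_ball_iff_norm.2 hz) w (mem_ball_iff_norm.2 hw)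
    rwa [dist_eq_norm, dist_eq_norm] at this
  have h1q : 0 < 1 - q := by linarith
  have hK0 : (0 : ℝ) ≤ K := K.2
  set E := A + D / (1 - q) with hE
  have hE0 : 0 ≤ E := by positivity
  -- E sums the deviation from the retract and the total geometric drift along it; M bounds the
  -- resulting excursion from z₀, so starting within R/(2M) traps the orbit in the ball of radius
  -- R/2.
  set M := E * (B * (1 + K)) + K + 1 with hM
  have hM1 : 1 ≤ M := by
    have : 0 ≤ E * (B * (1 + K)) := by positivity
    linarith
  refine ⟨R / (2 * M), by positivity, E * (B * (1 + K)) + 1, by positivity, fun z hz => ?_⟩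
  have hzM : M * ‖z - z₀‖ < R / 2 := by
    rw [lt_div_iff₀ (by positivity)] at hz
    linarith
  have hzR : ‖z - z₀‖ < R := by nlinarith [norm_nonneg (z - z₀)]
  have h0R : ‖z₀ - z₀‖ < R := by simpa using hR
  -- Used twice: with w = z₀ to trap the orbit, and with w the limit to measure the final estimate
  -- from that limit.
  have hVσ : ∀ w, ‖w - z₀‖ < R → σ w = w → V z ≤ B * (1 + K) * ‖z - w‖ := by
    intro w hw hσw
    have h1 := (hball' z hzR).1.1.2
    have h2 : ‖z - σ z‖ ≤ ‖z - w‖ + ‖σ w - σ z‖ := by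
      rw [hσw]
      exact norm_sub_le_norm_sub_add_norm_sub _ _ _
    have h3 := hσK w z hw hzR
    rw [norm_sub_rev w z] at h3
    calc V z ≤ B * ‖z - σ z‖ := h1
      _ ≤ B * (‖z - w‖ + K * ‖z - w‖) := by gcongr; linarith
      _ = _ := by ring
  have hVz := hVσ z₀ h0R hσ0
  have hV0 := hV z
  have main : ∀ n : ℕ, V (F^[n] z) ≤ q ^ n * V z ∧
      ‖σ (F^[n] z) - σ z‖ ≤ D * V z * ((1 - q ^ n) / (1 - q)) ∧
      ‖F^[n] z - σ (F^[n] z)‖ ≤ A * V (F^[n] z) ∧ ‖F^[n] z - z₀‖ < R / 2 := by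
    have close : ∀ n : ℕ, V (F^[n] z) ≤ q ^ n * V z →
        ‖σ (F^[n] z) - σ z‖ ≤ D * V z * ((1 - q ^ n) / (1 - q)) →
        ‖F^[n] z - σ (F^[n] z)‖ ≤ A * V (F^[n] z) → ‖F^[n] z - z₀‖ < R / 2 := by
      intro n ha hb hc
      have hqn : q ^ n ≤ 1 := pow_le_one₀ hq0 hq1.le
      have hqn0 : 0 ≤ q ^ n := pow_nonneg hq0 n
      have h1 : ‖F^[n] z - z₀‖ ≤ ‖F^[n] z - σ (F^[n] z)‖ + ‖σ (F^[n] z) - σ z‖ +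
          ‖σ z - σ z₀‖ := by
        rw [hσ0]
        have e : F^[n] z - z₀ = (F^[n] z - σ (F^[n] z)) + (σ (F^[n] z) - σ z) + (σ z - z₀) := by
          abel
        rw [e]
        exact norm_add₃_le
      have h2 : A * V (F^[n] z) ≤ A * V z := by
        gcongr
        nlinarith
      have h3 : D * V z * ((1 - q ^ n) / (1 - q)) ≤ D * V z * (1 / (1 - q)) := by
        gcongr
        linarith
      have h4 := hσK z z₀ hzR h0R
      have h5 : A * V z + D * V z * (1 / (1 - q)) = E * V z := by
        rw [hE]
        ring
      have h6 : E * V z ≤ E * (B * (1 + K) * ‖z - z₀‖) := by gcongr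
      have h7 : M * ‖z - z₀‖ = E * (B * (1 + K) * ‖z - z₀‖) + K * ‖z - z₀‖ + ‖z - z₀‖ := by
        rw [hM]
        ring
      linarith [norm_nonneg (z - z₀)]
    intro n
    induction n with
    | zero =>
      have ha : V (F^[0] z) ≤ q ^ 0 * V z := by simp
      have hb : ‖σ (F^[0] z) - σ z‖ ≤ D * V z * ((1 - q ^ 0) / (1 - q)) := by simp
      have hc : ‖F^[0] z - σ (F^[0] z)‖ ≤ A * V (F^[0] z) := (hball' z hzR).1.1.1.2
      exact ⟨ha, hb, hc, close 0 ha hb hc⟩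
    | succ n ih =>
      obtain ⟨ha, hb, -, hd⟩ := ih
      have hn := hball' (F^[n] z) (by linarith)
      have ha' : V (F^[n + 1] z) ≤ q ^ (n + 1) * V z := by
        rw [Function.iterate_succ_apply', pow_succ']
        calc _ ≤ q * V (F^[n] z) := hn.1.1.1.1.1
          _ ≤ q * (q ^ n * V z) := by gcongr
          _ = _ := by ring
      have hb' : ‖σ (F^[n + 1] z) - σ z‖ ≤ D * V z * ((1 - q ^ (n + 1)) / (1 - q)) := by
        rw [Function.iterate_succ_apply']
        have h1 := norm_sub_le_norm_sub_add_norm_sub (σ (F (F^[n] z))) (σ (F^[n] z)) (σ z)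
        have h2 := hn.1.1.1.1.2
        have h3 : D * V (F^[n] z) ≤ D * (q ^ n * V z) := by gcongr
        have h4 : D * V z * ((1 - q ^ (n + 1)) / (1 - q)) =
            D * V z * ((1 - q ^ n) / (1 - q)) + D * (q ^ n * V z) := by
          field_simp
          ring
        linarith
      have hc' : ‖F^[n + 1] z - σ (F^[n + 1] z)‖ ≤ A * V (F^[n + 1] z) := by
        rw [Function.iterate_succ_apply']
        exact hn.2.1
      exact ⟨ha', hb', hc', close (n + 1) ha' hb' hc'⟩
  have hgeo : ∀ n, dist (σ (F^[n] z)) (σ (F^[n + 1] z)) ≤ D * V z * q ^ n := by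
    intro n
    obtain ⟨ha, -, -, hd⟩ := main n
    have hn := hball' (F^[n] z) (by linarith)
    rw [dist_eq_norm, norm_sub_rev, Function.iterate_succ_apply']
    calc _ ≤ D * V (F^[n] z) := hn.1.1.1.1.2
      _ ≤ D * (q ^ n * V z) := by gcongr
      _ = _ := by ring
  obtain ⟨z', hz'⟩ := cauchySeq_tendsto_of_complete (cauchySeq_of_le_geometric q _ hq1 hgeo)
  have hrate : ∀ n : ℕ, ‖F^[n] z - z'‖ ≤ E * V z * q ^ n := by
    intro n
    have h1 := dist_le_of_le_geometric_of_tendsto q _ hq1 hgeo hz' n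
    rw [dist_eq_norm] at h1
    obtain ⟨ha, -, hc, -⟩ := main n
    have h2 := norm_sub_le_norm_sub_add_norm_sub (F^[n] z) (σ (F^[n] z)) z'
    have h3 : A * V (F^[n] z) ≤ A * (q ^ n * V z) := by gcongr
    have h4 : E * V z * q ^ n = A * (q ^ n * V z) + D * V z * q ^ n / (1 - q) := by
      rw [hE]
      ring
    linarith
  have hlim : Tendsto (fun n => F^[n] z) atTop (𝓝 z') := by
    rw [tendsto_iff_norm_sub_tendsto_zero]
    refine squeeze_zero (fun _ => norm_nonneg _) hrate ?_
    simpa using (tendsto_pow_atTop_nhds_zero_of_lt_one hq0 hq1).const_mul (E * V z)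
  -- The orbit stays within R/2, so the limit lies strictly inside the ball where σ is continuous.
  have hz'R : ‖z' - z₀‖ < R := by
    have h1 : Tendsto (fun n => ‖F^[n] z - z₀‖) atTop (𝓝 ‖z' - z₀‖) :=
      (hlim.sub_const z₀).norm
    have h2 := le_of_tendsto h1 (Eventually.of_forall fun n => (main n).2.2.2.le)
    linarith
  have hfix : σ z' = z' := by
    have hc : ContinuousAt σ z' :=
      hσR.continuousOn.continuousAt (Metric.isOpen_ball.mem_nhds (mem_ball_iff_norm.2 hz'R))
    exact tendsto_nhds_unique (hc.tendsto.comp hlim) hz'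
  refine ⟨z', (hball' z' hz'R).1.2, hfix, hlim, fun n => (hrate n).trans ?_⟩
  have h1 := hVσ z' hz'R hfix
  have hqn0 : 0 ≤ q ^ n := pow_nonneg hq0 n
  refine mul_le_mul_of_nonneg_right ?_ hqn0
  calc E * V z ≤ E * (B * (1 + K) * ‖z - z'‖) := by gcongr
    _ ≤ _ := by nlinarith [norm_nonneg (z - z')]

/-! ### Pairs of iterates in block coordinates -/

/-- The one-step map of the method on pairs of consecutive iterates. -/
noncomputable def pairStep {d : ℕ} (f : Vec d → ℝ) (α β : ℝ) (z : Vec d × Vec d) :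
    Vec d × Vec d :=
  (z.1 + β • (z.1 - z.2) - α • gradient f (z.1 + β • (z.1 - z.2)), z.1)

theorem iterate_pairStep {d : ℕ} (f : Vec d → ℝ) (α β : ℝ) (x₀ x₁ : Vec d) (n : ℕ) :
    (pairStep f α β)^[n] (x₁, x₀) = (iter f α β x₀ x₁ (n + 1), iter f α β x₀ x₁ n) := by
  induction n with
  | zero => simp [iter]
  | succ n ih =>
    rw [Function.iterate_succ_apply', ih, pairStep]
    simp only [iter]

/-- Coordinates of a pair in `N × N × T`. -/
noncomputable def blockCoord {d : ℕ} (f : Vec d → ℝ) (xs : Vec d) :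
    (Vec d × Vec d) →ₗ[ℝ] (normalSpace f xs × normalSpace f xs × tangentSpace f xs) :=
  (((normalSpace f xs).orthogonalProjectionOnto : Vec d →ₗ[ℝ] normalSpace f xs) ∘ₗ
      LinearMap.fst ℝ _ _).prod
    ((((normalSpace f xs).orthogonalProjectionOnto : Vec d →ₗ[ℝ] normalSpace f xs) ∘ₗ
        LinearMap.snd ℝ _ _).prod
      (((tangentSpace f xs).orthogonalProjectionOnto : Vec d →ₗ[ℝ] tangentSpace f xs) ∘ₗ
        LinearMap.snd ℝ _ _))

theorem blockCoord_apply {d : ℕ} (f : Vec d → ℝ) (xs a b : Vec d) :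
    blockCoord f xs (a, b) = ((normalSpace f xs).orthogonalProjectionOnto a,
      (normalSpace f xs).orthogonalProjectionOnto b,
      (tangentSpace f xs).orthogonalProjectionOnto b) := rfl

theorem norm_blockCoord_le {d : ℕ} (f : Vec d → ℝ) (xs : Vec d) (z : Vec d × Vec d) :
    ‖blockCoord f xs z‖ ≤ ‖z‖ := by
  obtain ⟨a, b⟩ := z
  rw [blockCoord_apply]
  refine max_le ?_ (max_le ?_ ?_)
  · exact (Submodule.norm_orthogonalProjectionOnto_apply_le _ a).trans (norm_fst_le (a, b))
  · exact (Submodule.norm_orthogonalProjectionOnto_apply_le _ b).trans (norm_snd_le (a, b))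
  · exact (Submodule.norm_orthogonalProjectionOnto_apply_le _ b).trans (norm_snd_le (a, b))

/-- The block coordinates omit the tangential part of a; on the subspace P a = β P b it is recovered
from that of b without increasing the norm. -/
theorem norm_le_two_mul_norm_blockCoord {d : ℕ} {f : Vec d → ℝ} {xs : Vec d} {β : ℝ}
    (hβ : β ∈ Ico (0 : ℝ) 1) {a b : Vec d}
    (hab : (tangentSpace f xs).starProjection a = β • (tangentSpace f xs).starProjection b) :
    ‖((a, b) : Vec d × Vec d)‖ ≤ 2 * ‖blockCoord f xs (a, b)‖ := by
  have hsplit : ∀ u : Vec d, ‖u‖ ≤ ‖(normalSpace f xs).orthogonalProjectionOnto u‖ +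
      ‖(tangentSpace f xs).starProjection u‖ := by
    intro u
    have h1 := (tangentSpace f xs).starProjection_add_starProjection_orthogonal u
    calc ‖u‖ = ‖(tangentSpace f xs).starProjection u +
        ((tangentSpace f xs)ᗮ).starProjection u‖ := by rw [h1]
      _ ≤ ‖(tangentSpace f xs).starProjection u‖ +
        ‖((tangentSpace f xs)ᗮ).starProjection u‖ := norm_add_le _ _
      _ = _ := add_comm _ _
  have hT : ‖(tangentSpace f xs).starProjection b‖ ≤ ‖blockCoord f xs (a, b)‖ :=
    (norm_snd_le (blockCoord f xs (a, b)).2).trans (norm_snd_le _)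
  have hNa : ‖(normalSpace f xs).orthogonalProjectionOnto a‖ ≤ ‖blockCoord f xs (a, b)‖ :=
    norm_fst_le (blockCoord f xs (a, b))
  have hNb : ‖(normalSpace f xs).orthogonalProjectionOnto b‖ ≤ ‖blockCoord f xs (a, b)‖ :=
    (norm_fst_le (blockCoord f xs (a, b)).2).trans (norm_snd_le _)
  refine max_le ?_ ?_
  · have h1 := hsplit a
    rw [hab, norm_smul, Real.norm_of_nonneg hβ.1] at h1
    have h2 : β * ‖(tangentSpace f xs).starProjection b‖ ≤
        1 * ‖(tangentSpace f xs).starProjection b‖ := by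
      gcongr
      exact hβ.2.le
    change ‖a‖ ≤ _
    linarith
  · have h1 := hsplit b
    change ‖b‖ ≤ _
    linarith

theorem normalStep_orthogonalProjectionOnto {d : ℕ} {f : Vec d → ℝ} {xs : Vec d}
    (hT : tangentSpace f xs = LinearMap.ker (hessian f xs)) (α : ℝ) (a : Vec d) :
    normalStep f xs α ((normalSpace f xs).orthogonalProjectionOnto a) =
      (normalSpace f xs).orthogonalProjectionOnto (a - α • hessian f xs a) := by
  have h1 : hessian f xs ((normalSpace f xs).orthogonalProjectionOnto a : Vec d) =
      hessian f xs a := by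
    have h2 := (tangentSpace f xs).starProjection_add_starProjection_orthogonal a
    have h3 : hessian f xs ((tangentSpace f xs).starProjection a) = 0 := by
      have h4 := (tangentSpace f xs).starProjection_apply_mem a
      exact hT.le h4
    conv_rhs => rw [← h2, map_add, h3, zero_add]
    rfl
  have h5 : normalHessian f xs ((normalSpace f xs).orthogonalProjectionOnto a) =
      (normalSpace f xs).orthogonalProjectionOnto (hessian f xs a) :=
    congrArg (normalSpace f xs).orthogonalProjectionOnto h1
  rw [normalStep, LinearMap.sub_apply, LinearMap.smul_apply, LinearMap.id_apply, h5, map_sub,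
    map_smul]

/-- The constraint P a = β P b cuts out the β-eigenspace of the tangential dynamics; it removes the
neutral eigenvalue 1, leaving the third block βI. -/
theorem blockCoord_linear_step {d : ℕ} {f : Vec d → ℝ} {xs : Vec d}
    (hT : tangentSpace f xs = LinearMap.ker (hessian f xs)) (α β : ℝ) {a b : Vec d}
    (hab : (tangentSpace f xs).starProjection a = β • (tangentSpace f xs).starProjection b) :
    blockCoord f xs (a + β • (a - b) - α • hessian f xs (a + β • (a - b)), a) =
      blockOp f xs α β (blockCoord f xs (a, b)) := by
  rw [blockCoord_apply, blockCoord_apply]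
  ext1
  · change _ = (1 + β) • normalStep f xs α ((normalSpace f xs).orthogonalProjectionOnto a) -
      β • normalStep f xs α ((normalSpace f xs).orthogonalProjectionOnto b)
    rw [← normalStep_orthogonalProjectionOnto hT]
    simp only [map_add, map_smul, map_sub, add_smul, one_smul, smul_sub]
    abel
  · ext1
    · rfl
    · exact Subtype.ext hab

end NAG

/-! ### Local linear convergence -/

namespace NAG

/-- Local linear convergence of the method with any factor exceeding `ρ_{α,β}`. -/
theorem convergesLinearly_of_rho_lt {d : ℕ} {f : Vec d → ℝ} (hf : ContDiff ℝ 2 f)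
    {xs : Vec d} (hmin : IsLocalMin f xs) (hPL : LocalPL f xs) {α β : ℝ}
    (hβ : β ∈ Ico (0 : ℝ) 1) {q : ℝ} (hρq : rho f xs α β < q) (hq1 : q < 1) {ε : ℝ}
    (hε : 0 < ε) : ConvergesLinearly f xs α β ε q := by
  have hT := tangentSpace_eq_ker hf hmin hPL
  obtain ⟨Ψ, hΨ0, hΨc, -, hΨ⟩ := exists_minSet_parametrization hf hmin hPL
  rw [← hT] at hΨ
  set P := (tangentSpace f xs).starProjection with hP
  have hPmem : ∀ u, P u ∈ tangentSpace f xs := fun u =>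
    (tangentSpace f xs).starProjection_apply_mem u
  have hPH : ∀ u, P (hessian f xs u) = 0 := fun u =>
    (Submodule.starProjection_apply_eq_zero_iff _).2 (by
      rw [hT]
      exact hessian_mem_orthogonal_ker hf xs u)
  have h1β : 0 < 1 - β := by linarith [hβ.2]
  -- The linear part contracts by q₁; the gap q - q₁ absorbs the nonlinear error.
  obtain ⟨q₁, hρq₁, hq₁q⟩ := exists_between hρq
  have hq₁0 : 0 ≤ q₁ := le_trans ENNReal.toReal_nonneg hρq₁.le
  obtain ⟨p, Cp, hCp, hpadd, hpB, hpge, hple⟩ := exists_adapted_norm (blockOp f xs α β) hρq₁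
  obtain ⟨Λ, S, hS, hΛ⟩ := (hΨc.hasStrictFDerivAt one_ne_zero).exists_lipschitzOnWith
  let y : Vec d × Vec d → Vec d := fun z => z.1 + β • (z.1 - z.2)
  -- The linearized step preserves P(z.1 - β z.2); dividing by 1 - β makes τ return the kernel
  -- coordinate of a minimizer x at the pair (x, x).
  let τ : Vec d × Vec d → Vec d := fun z => P ((1 - β)⁻¹ • (z.1 - β • z.2) - xs)
  let σ : Vec d × Vec d → Vec d × Vec d := fun z => (Ψ (τ z), Ψ (τ z))
  let F := pairStep f α β
  let J := blockCoord f xs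
  let V : Vec d × Vec d → ℝ := fun z => p (J (z - σ z))
  let z₀ : Vec d × Vec d := (xs, xs)
  have hτc : ContDiff ℝ 1 τ := by fun_prop
  have hyc : Continuous y := by fun_prop
  have hFc : Continuous F := by
    have := (contDiff_gradient hf).continuous
    change Continuous fun z : Vec d × Vec d => (y z - α • gradient f (y z), z.1)
    fun_prop
  have hτ0 : τ z₀ = 0 := by
    have h1 : (1 - β)⁻¹ • (xs - β • xs) - xs = 0 := by
      have h2 : xs - β • xs = (1 - β) • xs := by rw [sub_smul, one_smul]
      rw [h2, smul_smul, inv_mul_cancel₀ h1β.ne', one_smul, sub_self]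
    change P ((1 - β)⁻¹ • (xs - β • xs) - xs) = 0
    rw [h1, map_zero]
  have hy0 : y z₀ = xs := by simp [y, z₀]
  have hσ0 : σ z₀ = z₀ := by simp [σ, hτ0, hΨ0, z₀]
  have hF0 : F z₀ = z₀ := by
    simp [F, pairStep, z₀, gradient_eq_zero_of_isLocalMin hmin]
  have hΨτc : ContDiffAt ℝ 1 (fun z => Ψ (τ z)) z₀ := by
    refine ContDiffAt.comp z₀ ?_ hτc.contDiffAt
    rw [hτ0]
    exact hΨc
  have hσc : ContDiffAt ℝ 1 σ z₀ := hΨτc.prodMk hΨτc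
  obtain ⟨Kσ, Sσ, hSσ, hKσ⟩ := (hσc.hasStrictFDerivAt one_ne_zero).exists_lipschitzOnWith
  have hτt : Tendsto τ (𝓝 z₀) (𝓝 0) := by
    simpa [hτ0] using hτc.continuous.tendsto z₀
  have hFt : Tendsto F (𝓝 z₀) (𝓝 z₀) := by
    simpa [hF0] using hFc.tendsto z₀
  have hst : Tendsto (fun z => Ψ (τ z)) (𝓝 z₀) (𝓝 xs) := by
    have := hΨτc.continuousAt.tendsto
    simpa [hτ0, hΨ0] using this
  have hyt : Tendsto y (𝓝 z₀) (𝓝 xs) := by simpa [hy0] using hyc.tendsto z₀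
  have hgood : ∀ᶠ z in 𝓝 z₀, P (Ψ (τ z) - xs) = τ z ∧ Ψ (τ z) ∈ minSet f xs :=
    (hτt.eventually hΨ).mono fun z hz => hz (hPmem _)
  -- The deviation from the retract satisfies the constraint defining the stable subspace.
  have hstable : ∀ᶠ z in 𝓝 z₀, P (z.1 - Ψ (τ z)) = β • P (z.2 - Ψ (τ z)) := by
    filter_upwards [hgood] with z hz
    have h1 : P (Ψ (τ z)) = τ z + P xs := by
      have h0 := hz.1
      rw [map_sub] at h0
      exact sub_eq_iff_eq_add.1 h0
    have h2 : P z.1 - β • P z.2 = (1 - β) • (τ z + P xs) := by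
      simp only [τ, map_sub, map_smul, sub_add_cancel, smul_smul]
      rw [mul_inv_cancel₀ h1β.ne', one_smul]
    rw [map_sub, map_sub, h1, smul_sub, sub_eq_sub_iff_sub_eq_sub, h2, sub_smul, one_smul]
  have hdecomp : ∀ z, z - σ z = (z.1 - Ψ (τ z), z.2 - Ψ (τ z)) := fun z => rfl
  have hup : ∀ᶠ z in 𝓝 z₀, ‖z - σ z‖ ≤ 2 * V z := by
    filter_upwards [hstable] with z hz
    have h1 := norm_le_two_mul_norm_blockCoord hβ hz
    have h2 := hpge (J (z - σ z))
    rw [← hdecomp] at h1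
    exact h1.trans (by gcongr)
  have hlow : ∀ᶠ z in 𝓝 z₀, V z ≤ Cp * ‖z - σ z‖ := Eventually.of_forall fun z =>
    (hple _).trans (by gcongr; exact norm_blockCoord_le f xs _)
  have hV0 : ∀ z, 0 ≤ V z := fun z => (norm_nonneg _).trans (hpge _)
  set c := Λ * ((1 - β)⁻¹ * |α|) with hc
  have hc0 : 0 ≤ c := by positivity
  set κ := Cp * ((|α| + c) * 6) with hκ
  have hκ0 : 0 ≤ κ := by positivity
  set η := (q - q₁) / (κ + 1) with hη
  have hη0 : 0 < η := div_pos (by linarith) (by positivity)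
  have hηκ : κ * η ≤ q - q₁ := by
    have : (κ + 1) * η = q - q₁ := by
      rw [hη]
      field_simp
    nlinarith
  -- Strict differentiability at `xs` is essential: the base point Ψ(τ z) moves, yet the error is
  -- measured with the Hessian at `xs`.
  have herr : ∀ᶠ z in 𝓝 z₀, ‖gradient f (y z) - gradient f (Ψ (τ z)) -
      hessian f xs (y z - Ψ (τ z))‖ ≤ η * ‖y z - Ψ (τ z)‖ := by
    have h1 := (hasStrictFDerivAt_gradient hf xs).isLittleO.def hη0
    have h2 : Tendsto (fun z => (y z, Ψ (τ z))) (𝓝 z₀) (𝓝 (xs, xs)) := hyt.prodMk_nhds hst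
    exact h2.eventually h1
  have hstep : ∀ᶠ z in 𝓝 z₀, V (F z) ≤ q * V z ∧ ‖σ (F z) - σ z‖ ≤ c * (6 * η) * V z := by
    filter_upwards [hgood, hstable, hup, herr, hτt.eventually (show ∀ᶠ k in 𝓝 0, k ∈ S from hS),
      (hτt.comp hFt).eventually (show ∀ᶠ k in 𝓝 0, k ∈ S from hS)] with z hz hzs hzu hze hzS hFS
    set s := Ψ (τ z) with hs
    set s' := Ψ (τ (F z)) with hs'
    set a := z.1 - s with ha
    set b := z.2 - s with hb
    set e := gradient f (y z) - gradient f s - hessian f xs (y z - s) with he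
    have hgs : gradient f s = 0 := gradient_eq_zero_of_isLocalMin hz.2.1
    have hys : y z - s = a + β • (a - b) := by
      simp only [y, ha, hb, sub_sub_sub_cancel_right]
      abel
    have hgy : gradient f (y z) = hessian f xs (y z - s) + e := by
      rw [he, hgs]
      abel
    have hF1 : F z = (y z - α • gradient f (y z), z.1) := rfl
    have hab : ‖((a, b) : Vec d × Vec d)‖ ≤ 2 * V z := hzu
    have hna : ‖a‖ ≤ 2 * V z := (norm_fst_le (a, b)).trans hab
    have hnb : ‖b‖ ≤ 2 * V z := (norm_snd_le (a, b)).trans hab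
    have hnys : ‖y z - s‖ ≤ 6 * V z := by
      rw [hys]
      have h1 : ‖a + β • (a - b)‖ ≤ ‖a‖ + β * (‖a‖ + ‖b‖) := by
        refine (norm_add_le _ _).trans ?_
        rw [norm_smul, Real.norm_of_nonneg hβ.1]
        have := norm_sub_le a b
        have := hβ.1
        gcongr
      have h2 : β * (‖a‖ + ‖b‖) ≤ 1 * (‖a‖ + ‖b‖) := by
        have := hβ.2.le
        gcongr
      linarith
    have hne : ‖e‖ ≤ 6 * η * V z := by
      calc ‖e‖ ≤ η * ‖y z - s‖ := hze
        _ ≤ η * (6 * V z) := by gcongr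
        _ = _ := by ring
    -- The Hessian maps into the complement of T, so only the nonlinear error moves the base point.
    have hττ : τ (F z) - τ z = -(((1 - β)⁻¹ * α) • P e) := by
      have h1 : P (gradient f (y z)) = P e := by rw [hgy, map_add, hPH, zero_add]
      have h2 : τ (F z) - τ z = P ((1 - β)⁻¹ • (-(α • gradient f (y z)))) := by
        simp only [τ, hF1]
        rw [← map_sub]
        congr 1
        simp only [y]
        module
      rw [h2, map_smul, map_neg, map_smul, h1, smul_neg, smul_smul]
    have hnττ : ‖τ (F z) - τ z‖ ≤ (1 - β)⁻¹ * |α| * ‖e‖ := by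
      rw [hττ, norm_neg, norm_smul, Real.norm_eq_abs, abs_mul, abs_of_pos (inv_pos.2 h1β)]
      gcongr
      exact (tangentSpace f xs).norm_starProjection_apply_le e
    have hss : ‖s' - s‖ ≤ c * ‖e‖ := by
      have h1 := hΛ.dist_le_mul _ hFS _ hzS
      rw [dist_eq_norm, dist_eq_norm] at h1
      calc ‖s' - s‖ ≤ Λ * ‖τ (F z) - τ z‖ := h1
        _ ≤ Λ * ((1 - β)⁻¹ * |α| * ‖e‖) := by gcongr
        _ = _ := by rw [hc]; ring
    constructor
    · have h1 : F z - σ (F z) =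
          (a + β • (a - b) - α • hessian f xs (a + β • (a - b)), a) +
            (-(α • e) - (s' - s), -(s' - s)) := by
        rw [← hys]
        change (y z - α • gradient f (y z) - s', z.1 - s') = _
        rw [hgy]
        ext1
        · simp only [Prod.fst_add]
          module
        · simp only [Prod.snd_add, ha]
          module
      have h2 : V (F z) ≤ q₁ * V z + Cp * ((|α| + c) * ‖e‖) := by
        change p (J (F z - σ (F z))) ≤ _
        rw [h1, map_add]
        refine (hpadd _ _).trans (add_le_add ?_ ?_)
        · have h3 := blockCoord_linear_step hT α β (a := a) (b := b) hzs
          change p (blockCoord f xs _) ≤ _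
          rw [h3]
          exact hpB _
        · refine (hple _).trans ?_
          gcongr
          refine (norm_blockCoord_le f xs _).trans ?_
          have h4 : ‖-(α • e)‖ = |α| * ‖e‖ := by rw [norm_neg, norm_smul, Real.norm_eq_abs]
          refine max_le ?_ ?_
          · change ‖-(α • e) - (s' - s)‖ ≤ _
            have := norm_sub_le (-(α • e)) (s' - s)
            linarith
          · change ‖-(s' - s)‖ ≤ _
            rw [norm_neg]
            have : 0 ≤ |α| * ‖e‖ := by positivity
            linarith
      calc V (F z) ≤ q₁ * V z + Cp * ((|α| + c) * ‖e‖) := h2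
        _ ≤ q₁ * V z + Cp * ((|α| + c) * (6 * η * V z)) := by gcongr
        _ = q₁ * V z + κ * η * V z := by rw [hκ]; ring
        _ ≤ q₁ * V z + (q - q₁) * V z := by
          gcongr
          exact hV0 z
        _ = q * V z := by ring
    · have h1 : ‖σ (F z) - σ z‖ = ‖s' - s‖ := by
        change ‖(s' - s, s' - s)‖ = _
        simp [Prod.norm_def]
      rw [h1]
      calc ‖s' - s‖ ≤ c * ‖e‖ := hss
        _ ≤ c * (6 * η * V z) := by gcongr
        _ = _ := by ring
  have hprop : ∀ᶠ z in 𝓝 z₀, Ψ (τ z) ∈ minSet f xs ∧ ‖z.1 - xs‖ < ε := by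
    have h1 : ∀ᶠ z : Vec d × Vec d in 𝓝 z₀, ‖z.1 - xs‖ < ε := by
      have h2 : Continuous fun z : Vec d × Vec d => ‖z.1 - xs‖ := by fun_prop
      refine h2.continuousAt.eventually_lt continuousAt_const ?_
      simpa [z₀] using hε
    exact (hgood.mono fun z hz => hz.2).and h1
  obtain ⟨δ, hδ, C, hC, hconv⟩ := exists_limit_of_contracts_to_retract (hq₁0.trans hq₁q.le) hq1
    (by positivity : 0 ≤ c * (6 * η)) zero_le_two hCp.le hSσ hKσ hσ0 hFc.continuousAt hF0 hV0
    hstep hup hlow hprop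
  refine ⟨Metric.ball xs δ, Metric.isOpen_ball, Metric.mem_ball_self hδ, C, hC, ?_⟩
  intro x₀ hx₀ x₁ hx₁
  rw [mem_ball_iff_norm] at hx₀ hx₁
  obtain ⟨z', ⟨hz'S, hz'ε⟩, hz'σ, hz't, hz'r⟩ := hconv (x₁, x₀) (max_lt hx₁ hx₀)
  have e1 : Ψ (τ z') = z'.1 := congrArg Prod.fst hz'σ
  have e2 : Ψ (τ z') = z'.2 := congrArg Prod.snd hz'σ
  have e3 : z' = (z'.1, z'.1) := Prod.ext rfl (e2.symm.trans e1)
  refine ⟨z'.1, e1 ▸ hz'S, hz'ε, ?_, ?_⟩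
  · have h1 : Tendsto (fun n => (F^[n] (x₁, x₀)).2) atTop (𝓝 z'.2) :=
      (continuous_snd.tendsto z').comp hz't
    simp only [F, iterate_pairStep] at h1
    rwa [← e2, e1] at h1
  · intro n _
    have h1 := hz'r n
    simp only [F, iterate_pairStep] at h1
    have h2 := (norm_snd_le _).trans h1
    have h3 : ‖(x₁, x₀) - z'‖ ≤ ‖x₁ - z'.1‖ + ‖x₀ - z'.1‖ := by
      rw [e3]
      exact max_le (le_add_of_nonneg_right (norm_nonneg _))
        (le_add_of_nonneg_left (norm_nonneg _))
    -- The second component of the n-th pair is x^n, so the exponent needs no shift.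
    have h4 : iter f α β x₀ x₁ n - z'.1 =
        ((iter f α β x₀ x₁ (n + 1), iter f α β x₀ x₁ n) - z').2 := by
      change _ = iter f α β x₀ x₁ n - z'.2
      rw [← e2, e1]
    rw [h4]
    refine h2.trans ?_
    have hq0 : 0 ≤ q ^ n := pow_nonneg (hq₁0.trans hq₁q.le) n
    gcongr

theorem ConvergesLinearly.mono {d : ℕ} {f : Vec d → ℝ} {xs : Vec d} {α β ε q q' : ℝ}
    (h : ConvergesLinearly f xs α β ε q) (hq : 0 ≤ q) (hqq' : q ≤ q') :
    ConvergesLinearly f xs α β ε q' := by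
  obtain ⟨U, hU, hxU, C, hC, h⟩ := h
  refine ⟨U, hU, hxU, C, hC, fun x₀ h₀ x₁ h₁ => ?_⟩
  obtain ⟨x', hx', hε, ht, hr⟩ := h x₀ h₀ x₁ h₁
  exact ⟨x', hx', hε, ht, fun n hn => (hr n hn).trans (by gcongr)⟩

theorem convergesLinearly_rho_add {d : ℕ} {f : Vec d → ℝ} (hf : ContDiff ℝ 2 f)
    {xs : Vec d} (hmin : IsLocalMin f xs) (hPL : LocalPL f xs) {α β : ℝ}
    (hβ : β ∈ Ico (0 : ℝ) 1) (hρ : rho f xs α β < 1) {ε : ℝ} (hε : 0 < ε) :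
    ConvergesLinearly f xs α β ε (rho f xs α β + ε) := by
  -- ρ + ε may exceed 1, whereas the contraction argument needs a factor below 1.
  obtain ⟨q, hq, hq'⟩ := exists_between (lt_min (lt_add_of_pos_right (rho f xs α β) hε) hρ)
  have hρ0 : 0 ≤ rho f xs α β := ENNReal.toReal_nonneg
  exact (convergesLinearly_of_rho_lt hf hmin hPL hβ hq (hq'.trans_le (min_le_right _ _)) hε).mono
    (hρ0.trans hq.le) (hq'.le.trans (min_le_left _ _))

end NAG

/-! ### The main theorem -/

theorem theorem2p2 {d : ℕ} (f : NAG.Vec d → ℝ) (hf : ContDiff ℝ 2 f) (xs : NAG.Vec d)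
    (hmin : IsLocalMin f xs) (hPL : NAG.LocalPL f xs)
    (hnc : ¬ ∀ᶠ x in 𝓝 xs, f x = f xs)
    (L μ : ℝ) (hL : L = NAG.lipConst f xs) (hμ : μ = NAG.muConst f xs) :
    (∀ ε : ℝ, 0 < ε → ∀ β ∈ Ico (0 : ℝ) 1,
      ∀ α ∈ Ioo (0 : ℝ) (2 * (β + 1) / ((L + ε) * (2 * β + 1))),
        NAG.rho f xs α β ∈ Ico (0 : ℝ) 1 ∧
        NAG.ConvergesLinearly f xs α β ε (NAG.rho f xs α β + ε)) ∧
    (NAG.betaOpt L μ ∈ Ico (0 : ℝ) 1 ∧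
      NAG.alphaOpt L μ ∈
        Ioo (0 : ℝ) (2 * (NAG.betaOpt L μ + 1) / (L * (2 * NAG.betaOpt L μ + 1))) ∧
      NAG.rho f xs (NAG.alphaOpt L μ) (NAG.betaOpt L μ) = NAG.rhoOpt L μ ∧
      (∀ β ∈ Ico (0 : ℝ) 1, ∀ α ∈ Ioo (0 : ℝ) (2 * (β + 1) / (L * (2 * β + 1))),
        NAG.rhoOpt L μ ≤ NAG.rho f xs α β) ∧
      ∀ ε : ℝ, 0 < ε →
        NAG.ConvergesLinearly f xs (NAG.alphaOpt L μ) (NAG.betaOpt L μ) ε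
          (NAG.rhoOpt L μ + ε)) := by
  have hT := NAG.tangentSpace_eq_ker hf hmin hPL
  have hfin := NAG.finite_eigenvalues_normalHessian f xs
  have hne := NAG.nonempty_eigenvalues_normalHessian hf hT
    (NAG.ker_hessian_ne_top hf hmin hPL hnc)
  have hμmem : Module.End.HasEigenvalue (NAG.normalHessian f xs) μ := by
    rw [hμ]
    exact hne.csInf_mem hfin
  have hLmem : Module.End.HasEigenvalue (NAG.normalHessian f xs) L := by
    rw [hL]
    exact hne.csSup_mem hfin
  have hle : ∀ h, Module.End.HasEigenvalue (NAG.normalHessian f xs) h → μ ≤ h ∧ h ≤ L := by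
    intro h hh
    rw [hμ, hL]
    exact ⟨csInf_le hfin.bddBelow hh, le_csSup hfin.bddAbove hh⟩
  have hpos : ∀ h, Module.End.HasEigenvalue (NAG.normalHessian f xs) h → 0 < h := fun h hh =>
    NAG.pos_of_hasEigenvalue_normalHessian hf hmin hT hh
  have hμ0 := hpos μ hμmem
  have hL0 := hpos L hLmem
  have hμL := (hle μ hμmem).2
  have hρ0 : ∀ α β, 0 ≤ NAG.rho f xs α β := fun α β => ENNReal.toReal_nonneg
  have hρ1 : ∀ β ∈ Ico (0 : ℝ) 1, ∀ α ∈ Ioo (0 : ℝ) (2 * (β + 1) / (L * (2 * β + 1))),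
      NAG.rho f xs α β < 1 := by
    intro β hβ α hα
    refine NAG.realSpectralRadius_lt _ one_pos fun z hz => ?_
    rcases NAG.eq_or_root_of_mem_spectrum_blockOp hf hT hz with rfl | ⟨h, hh, hr⟩
    · rw [Complex.norm_real, Real.norm_of_nonneg hβ.1]
      exact hβ.2
    · exact NAG.norm_root_lt_one hβ (hpos h hh) (hle h hh).2 hα hr
  have hlower : ∀ β ∈ Ico (0 : ℝ) 1, ∀ α ∈ Ioo (0 : ℝ) (2 * (β + 1) / (L * (2 * β + 1))),
      NAG.rhoOpt L μ ≤ NAG.rho f xs α β := fun β hβ α hα =>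
    NAG.rhoOpt_le_of_roots hμ0 hμL hβ hα.1 (hρ0 α β)
      (fun z hz => NAG.norm_le_realSpectralRadius _ (NAG.mem_spectrum_blockOp_of_root hμmem hz))
      (fun z hz => NAG.norm_le_realSpectralRadius _ (NAG.mem_spectrum_blockOp_of_root hLmem hz))
  have hβo := NAG.betaOpt_mem hμ0 hμL
  have hαo := NAG.alphaOpt_mem hμ0 hμL
  have hρo : NAG.rho f xs (NAG.alphaOpt L μ) (NAG.betaOpt L μ) = NAG.rhoOpt L μ := by
    refine le_antisymm ?_ (hlower _ hβo _ hαo)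
    refine NAG.realSpectralRadius_le _ (NAG.rhoOpt_nonneg hμ0 hμL) fun z hz => ?_
    rcases NAG.eq_or_root_of_mem_spectrum_blockOp hf hT hz with rfl | ⟨h, hh, hr⟩
    · rw [Complex.norm_real, Real.norm_of_nonneg hβo.1]
      exact NAG.betaOpt_le_rhoOpt hμ0 hμL
    · exact NAG.norm_root_le_rhoOpt hμ0 (hle h hh).1 (hle h hh).2 hr
  refine ⟨fun ε hε β hβ α hα => ?_, hβo, hαo, hρo, hlower, fun ε hε => ?_⟩
  · have hα' : α ∈ Ioo (0 : ℝ) (2 * (β + 1) / (L * (2 * β + 1))) := by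
      refine ⟨hα.1, hα.2.trans_le ?_⟩
      have := hβ.1
      gcongr
      linarith
    exact ⟨⟨hρ0 α β, hρ1 β hβ α hα'⟩,
      NAG.convergesLinearly_rho_add hf hmin hPL hβ (hρ1 β hβ α hα') hε⟩
  · rw [← hρo]
    exact NAG.convergesLinearly_rho_add hf hmin hPL hβo (hρ1 _ hβo _ hαo) hε
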